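/- Let $0<p<1/2$. Let $\mathbb D$ be the unit disk and $\partial\mathbb D$ the unit circle, with $|\cdot|$ denoting arc length on $\partial\mathbb D$. For a finite positive Borel measure $\mu$ on $\partial\mathbb D$ put $$S_\mu(z)=\exp\Bigl(-\int_{\partial\mathbb D}\frac{\zeta+z}{\zeta-z}\,d\mu(\zeta)\Bigr),\qquad |z|<1.$$ We say that $S_\mu$ satisfies the $(1+p)$-area condition if for every $0<c<1$ $$\int_{\{z\in\mathbb D:\,|S_\mu(z)|<c\}}\frac{dA(z)}{(1-|z|)^{1+p}}<\infty .$$ A $(1-p)$-Beurling–Carleson set is a closed set $E\subset\partial\mathbb D$ of zero length whose complementary arcs $\{J\}$ (the connected components of $\partial\mathbb D\setminus E$) satisfy $\sum_J|J|^{1-p}<\infty$. The Hardy space $H^p$ consists of the analytic functions $f$ on $\mathbb D$ with $\sup_{0\le r<1}\int_{0}^{2\pi}|f(re^{i\theta})|^p\,d\theta<\infty$. (a) If a finite positive measure $\mu$ is supported on a $(1-p)$-Beurling–Carleson set $E$ (that is, $\mu(\partial\mathbb D\setminus E)=0$) and $S_\mu$ satisfies the $(1+p)$-area condition, then $S_\mu'\in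 H^p$. (b) Let $\mu$ be a finite positive measure on $\partial\mathbb D$ that is singular with respect to arc length. Then $\mu$ can be written as a countable sum $\mu=\sum_k\mu_k$ of finite positive measures such that every $S_{\mu_k}$ satisfies the $(1+p)$-area condition if and only if $\mu$ can be written as a countable sum $\mu=\sum_k\mu_k$ of finite positive measures such that $S_{\mu_k}'\in H^p$ for every $k$. -/

import Mathlib

open MeasureTheory Set
open scoped ENNReal

noncomputable section

/-- The Borel `σ`-algebra of the unit circle. -/
instance circleMeasurableSpace : MeasurableSpace Circle := borel Circle

instance circleBorelSpace : BorelSpace Circle := ⟨rfl⟩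

/-- Arc length on the unit circle (total mass `2π`). -/
def circleArcLength : Measure Circle :=
  Measure.map Circle.exp (volume.restrict (Ioc (-Real.pi) Real.pi))

/-- The complementary arcs of `E`: the connected components of the complement of `E`. -/
def complementaryArcs (E : Set Circle) : Set (Set Circle) :=
  {J | ∃ x ∈ Eᶜ, J = connectedComponentIn Eᶜ x}

/-- `α`-Beurling–Carleson sets: closed sets of zero length whose complementary arcs `J`
satisfy `∑ |J| ^ α < ∞`. -/
structure IsBeurlingCarleson (α : ℝ) (E : Set Circle) : Prop where
  isClosed : IsClosed E
  length_eq_zero : circleArcLength E = 0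
  sum_lt_top : ∑' J : complementaryArcs E, circleArcLength J.1 ^ α < ∞

/-- The singular inner function `S_μ(z) = exp (-∫ (ζ + z) / (ζ - z) dμ(ζ))`, `|z| < 1`. -/
def singularInner (μ : Measure Circle) (z : ℂ) : ℂ :=
  Complex.exp (-∫ ζ : Circle, ((ζ : ℂ) + z) / ((ζ : ℂ) - z) ∂μ)

/-- `S_μ` satisfies the `s`-area condition: for every `0 < c < 1`, the integral of
`(1 - |z|) ^ (-s)` over `{z ∈ 𝔻 : |S_μ(z)| < c}` with respect to area is finite. -/
def AreaCondition (s : ℝ) (μ : Measure Circle) : Prop :=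
  ∀ c : ℝ, 0 < c → c < 1 →
    ∫⁻ z in {z : ℂ | ‖z‖ < 1 ∧ ‖singularInner μ z‖ < c},
      ENNReal.ofReal (1 / (1 - ‖z‖) ^ s) < ∞

/-- The Hardy space `H^p` of the unit disk, `0 < p < ∞`. -/
def MemHardy (p : ℝ) (f : ℂ → ℂ) : Prop :=
  DifferentiableOn ℂ f (Metric.ball 0 1) ∧
    ⨆ r : Ico (0 : ℝ) 1, ∫⁻ ζ : Circle, ‖f ((r : ℝ) * (ζ : ℂ))‖ₑ ^ p ∂circleArcLength < ∞

/-- `μ` satisfies `P` up to countable sums: it is a countable sum of finite positive measures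
each of which satisfies `P`. (A finite sum is padded with zero measures.) -/
def UpToCountableSums (P : Measure Circle → Prop) (μ : Measure Circle) : Prop :=
  ∃ ν : ℕ → Measure Circle,
    (∀ k, IsFiniteMeasure (ν k) ∧ P (ν k)) ∧ μ = Measure.sum ν

end

/-!
Everything goes through the inverse square potential `V_μ(z) = ∫ |ξ - z|⁻² dμ(ξ)`, because
`|S_μ(z)| = exp (-(1 - |z|²) V_μ(z))` and `|S_μ'| ≤ 2 V_μ`. Since `V_μ(rζ) ≤ 4 V_μ(ζ)`,
integrability of `V_μ ^ p` over the circle implies both the area condition and `S_μ' ∈ H ^ p`.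

Let `μ` live on a Beurling–Carleson set `E`. At `ζ ∉ E`, either `V_μ(ζ)` is at most a multiple of
`dist(ζ, E)⁻¹`, whose `p`-th power is integrable by the condition on the arcs, or `|S_μ|` is small
on the part of the radius at distance comparable to `V_μ(ζ)⁻¹` from `ζ`, so that the area integral
over this radius dominates `V_μ(ζ) ^ p`. Hence the area condition makes `V_μ ^ p` integrable.

If `μ` is singular, then `S_μ` is small near the end of the radius at `μ`-almost every point. The
set of points where this happens on a final segment of length `δ` is closed, and `S_μ` is small on
the Stolz angles over it. When the area condition holds, this set is therefore a Beurling–Carleson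
set, and countably many of these sets carry `μ`.

Conversely, if `S_μ' ∈ H ^ p` then `|S_μ'| ^ p` is dominated by the Poisson integral of a finite
measure, so `S_μ'` is bounded along almost every radius. By singularity `|S_μ| → 1` along almost
every radius, and together these force `V_μ < ∞` almost everywhere on the circle. Then
`|S_μ'| → 2 V_μ` radially, and Fatou's lemma gives the integrability of `V_μ ^ p`.
-/

open Filter Metric
open scoped Topology Real

/-! ### Arc length and complementary arcs -/

lemma circleArcLength_eq_map (t : ℝ) :
    circleArcLength = (volume.restrict (Ioc t (t + 2 * π))).map Circle.exp := by
  have : Fact (0 < 2 * π) := ⟨by positivity⟩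
  have key (s : ℝ) : (volume.restrict (Ioc s (s + 2 * π))).map Circle.exp =
      (volume : Measure (AddCircle (2 * π))).map AddCircle.homeomorphCircle' := by
    rw [← (AddCircle.measurePreserving_mk (2 * π) s).map_eq,
      Measure.map_map AddCircle.homeomorphCircle'.continuous.measurable
        (AddCircle.measurePreserving_mk (2 * π) s).measurable]
    exact congrArg (Measure.map · _) (funext fun _ ↦ (AddCircle.homeomorphCircle'_apply_mk _).symm)
  rw [key, ← key (-π), circleArcLength]
  congr 3
  ring

lemma lintegral_circleArcLength {g : Circle → ℝ≥0∞} (hg : Measurable g) (t : ℝ) :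
    ∫⁻ ζ, g ζ ∂circleArcLength = ∫⁻ θ in Ioc t (t + 2 * π), g (Circle.exp θ) := by
  rw [circleArcLength_eq_map t, lintegral_map hg Circle.exp.continuous.measurable]

lemma circleArcLength_apply {s : Set Circle} (hs : MeasurableSet s) (t : ℝ) :
    circleArcLength s = volume (Ioc t (t + 2 * π) ∩ Circle.exp ⁻¹' s) := by
  have hexp := Circle.exp.continuous.measurable
  rw [circleArcLength_eq_map t, Measure.map_apply hexp hs, Measure.restrict_apply (hexp hs),
    inter_comm]

instance : IsFiniteMeasure circleArcLength := by
  rw [circleArcLength]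
  infer_instance

lemma dist_circle_eq_norm_sub (ζ ξ : Circle) : dist ζ ξ = ‖(ζ : ℂ) - ξ‖ :=
  dist_eq_norm (ζ : ℂ) ξ

lemma edist_circle_eq_enorm_sub (ζ ξ : Circle) : edist ζ ξ = ‖(ζ : ℂ) - ξ‖ₑ :=
  edist_eq_enorm_sub (ζ : ℂ) ξ

lemma dist_circleExp (x y : ℝ) :
    dist (Circle.exp x) (Circle.exp y) = 2 * |Real.sin ((x - y) / 2)| := by
  have h : (Circle.exp x : ℂ) - Circle.exp y =
      Circle.exp y * (Complex.exp (Complex.I * ((x - y : ℝ) : ℂ)) - 1) := by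
    rw [Circle.coe_exp, Circle.coe_exp, mul_sub, ← Complex.exp_add, mul_one]
    congr 2
    push_cast
    ring
  rw [dist_circle_eq_norm_sub, h, norm_mul, Circle.norm_coe, one_mul,
    Complex.norm_exp_I_mul_ofReal_sub_one]
  simp

lemma dist_circleExp_le (x y : ℝ) : dist (Circle.exp x) (Circle.exp y) ≤ |x - y| := by
  have := Real.abs_sin_le_abs (x := (x - y) / 2)
  rw [abs_div, abs_two] at this
  rw [dist_circleExp]
  linarith

lemma le_dist_circleExp {x y : ℝ} (h : |x - y| ≤ π) :
    2 / π * |x - y| ≤ dist (Circle.exp x) (Circle.exp y) := by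
  have := Real.mul_abs_le_abs_sin (x := (x - y) / 2) (by rw [abs_div, abs_two]; linarith)
  rw [abs_div, abs_two] at this
  rw [dist_circleExp]
  linarith

lemma le_circleArcLength_closedBall (ζ : Circle) {h : ℝ} (h_le : h ≤ 1) :
    ENNReal.ofReal h ≤ circleArcLength (closedBall ζ h) := by
  obtain ⟨θ, rfl⟩ := Circle.exp_surjective ζ
  rw [circleArcLength_apply measurableSet_closedBall θ]
  calc ENNReal.ofReal h = volume (Ioc θ (θ + h)) := by simp
    _ ≤ _ := by
      refine measure_mono fun x ⟨hθx, hxh⟩ ↦ ⟨⟨hθx, by linarith [Real.pi_gt_three]⟩, ?_⟩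
      exact (dist_circleExp_le x θ).trans (abs_le.2 ⟨by linarith, by linarith⟩)

lemma circleArcLength_closedBall_le (ζ : Circle) (h : ℝ) :
    circleArcLength (closedBall ζ h) ≤ ENNReal.ofReal (π * h) := by
  obtain ⟨θ, rfl⟩ := Circle.exp_surjective ζ
  rw [circleArcLength_apply measurableSet_closedBall (θ - π)]
  calc _ ≤ volume (closedBall θ (π / 2 * h)) := by
        refine measure_mono fun x ⟨⟨hx₁, hx₂⟩, hx⟩ ↦ ?_
        have hπ : |x - θ| ≤ π := abs_le.2 ⟨by linarith, by linarith⟩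
        rw [mem_closedBall, Real.dist_eq]
        calc |x - θ| = π / 2 * (2 / π * |x - θ|) := by field_simp
          _ ≤ π / 2 * h := by
            gcongr
            exact (le_dist_circleExp hπ).trans hx
    _ = ENNReal.ofReal (π * h) := by
        rw [Real.volume_closedBall]
        congr 1
        ring

lemma lintegral_polar {F : ℂ → ℝ≥0∞} (hF : Measurable F) :
    ∫⁻ z, F z = ∫⁻ ζ : Circle, (∫⁻ r in Ioi (0 : ℝ), ENNReal.ofReal r * F (r * ζ))
      ∂circleArcLength := by
  have hm : Measurable fun q : Circle × ℝ ↦ ENNReal.ofReal q.2 * F (q.2 * q.1) := by fun_prop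
  have hpolar (q : ℝ × ℝ) : (q.1 * (Real.cos q.2 + Real.sin q.2 * Complex.I) : ℂ) =
      q.1 * (Circle.exp q.2 : ℂ) := by
    rw [Circle.coe_exp, Complex.exp_mul_I, Complex.ofReal_cos, Complex.ofReal_sin]
  rw [← Complex.lintegral_comp_polarCoord_symm, polarCoord_target,
    lintegral_circleArcLength (Measurable.lintegral_prod_right hm) (-π)]
  simp_rw [Complex.polarCoord_symm_apply, hpolar, smul_eq_mul]
  rw [Measure.volume_eq_prod, ← Measure.prod_restrict, lintegral_prod_symm',
    show -π + 2 * π = π by ring, restrict_Ioo_eq_restrict_Ioc]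
  exact hm.comp ((Circle.exp.continuous.measurable.comp measurable_snd).prodMk measurable_fst)

lemma exists_Ioo_disjoint_of_notMem {F : Set ℝ} (hF : IsClosed F) {l x u : ℝ} (hl : l ∈ F)
    (hlx : l ≤ x) (hu : u ∈ F) (hxu : x ≤ u) (hx : x ∉ F) :
    ∃ a ∈ F, ∃ b ∈ F, x ∈ Ioo a b ∧ Disjoint (Ioo a b) F := by
  obtain ⟨a, ⟨haF, -, hax⟩, ha⟩ :=
    (isCompact_Icc.inter_left hF).exists_isGreatest ⟨l, hl, le_rfl, hlx⟩
  obtain ⟨b, ⟨hbF, hxb, -⟩, hb⟩ :=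
    (isCompact_Icc.inter_left hF).exists_isLeast ⟨u, hu, hxu, le_rfl⟩
  have hla : l ≤ a := ha ⟨hl, le_rfl, hlx⟩
  have hbu : b ≤ u := hb ⟨hu, hxu, le_rfl⟩
  refine ⟨a, haF, b, hbF, ⟨hax.lt_of_ne (ne_of_mem_of_not_mem haF hx),
    hxb.lt_of_ne' (ne_of_mem_of_not_mem hbF hx)⟩, Set.disjoint_left.2 fun t ⟨hat, htb⟩ htF ↦ ?_⟩
  rcases le_total t x with htx | hxt
  · exact hat.not_ge (ha ⟨htF, hla.trans hat.le, htx⟩)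
  · exact htb.not_ge (hb ⟨htF, hxt, htb.le.trans hbu⟩)

lemma connectedComponentIn_compl_eq_image_Ioo {X : Type*} [TopologicalSpace X] [T2Space X]
    {f : ℝ → X} (hf : Continuous f) (hf_open : IsOpenMap f) {E : Set X} {a b x : ℝ}
    (ha : f a ∈ E) (hb : f b ∈ E) (hx : x ∈ Ioo a b) (hE : Disjoint (Ioo a b) (f ⁻¹' E)) :
    connectedComponentIn Eᶜ (f x) = f '' Ioo a b := by
  have hmaps : f '' Ioo a b ⊆ Eᶜ := by
    rintro _ ⟨t, ht, rfl⟩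
    exact Set.disjoint_left.1 hE ht
  refine Subset.antisymm ?_ <| (isPreconnected_Ioo.image _ hf.continuousOn)
    |>.subset_connectedComponentIn (mem_image_of_mem f hx) hmaps
  refine isPreconnected_connectedComponentIn.subset_of_closure_inter_subset
    (hf_open _ isOpen_Ioo)
    ⟨_, mem_connectedComponentIn (hmaps (mem_image_of_mem f hx)), mem_image_of_mem f hx⟩ ?_
  rintro y ⟨hy_closure, hy_comp⟩
  have hclosure : closure (f '' Ioo a b) ⊆ f '' Icc a b :=
    closure_minimal (image_mono Ioo_subset_Icc_self) (isCompact_Icc.image hf).isClosed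
  obtain ⟨t, ht, rfl⟩ := hclosure hy_closure
  have htE : f t ∉ E := connectedComponentIn_subset _ _ hy_comp
  exact ⟨t, ⟨ht.1.lt_of_ne (by rintro rfl; exact htE ha),
    ht.2.lt_of_ne (by rintro rfl; exact htE hb)⟩, rfl⟩

lemma exists_eq_circleExp_image_Ioo {E J : Set Circle} (hE : IsClosed E) (hne : E.Nonempty)
    (hJ : J ∈ complementaryArcs E) :
    ∃ a b : ℝ, b ≤ a + 2 * π ∧ J = Circle.exp '' Ioo a b ∧ Circle.exp a ∈ E ∧
      Disjoint (Ioo a b) (Circle.exp ⁻¹' E) := by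
  obtain ⟨_, hx, rfl⟩ := hJ
  obtain ⟨x, rfl⟩ := Circle.exp_surjective ‹Circle›
  obtain ⟨ξ, hξ⟩ := hne
  obtain ⟨φ, rfl⟩ := Circle.exp_surjective ξ
  have hperiod (c : ℝ) : ∃ y ∈ Ico c (c + 2 * π), y ∈ Circle.exp ⁻¹' E := by
    obtain ⟨y, hy, hφy⟩ := Circle.periodic_exp.exists_mem_Ico (by positivity) φ c
    exact ⟨y, hy, by rwa [mem_preimage, ← hφy]⟩
  obtain ⟨l, hl, hlE⟩ := hperiod (x - 2 * π)
  obtain ⟨u, hu, huE⟩ := hperiod x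
  obtain ⟨a, ha, b, hb, hxab, hdisj⟩ := exists_Ioo_disjoint_of_notMem
    (hE.preimage Circle.exp.continuous) hlE (by linarith [hl.2]) huE hu.1 hx
  refine ⟨a, b, ?_, connectedComponentIn_compl_eq_image_Ioo Circle.exp.continuous
    isLocalHomeomorph_circleExp.isOpenMap ha hb hxab hdisj, ha, hdisj⟩
  by_contra! hlong
  exact Set.disjoint_left.1 hdisj ⟨by linarith [Real.pi_pos], hlong⟩
    (by rwa [mem_preimage, Circle.exp_add_two_pi])

lemma setLIntegral_circleExp_image_Ioo {a b : ℝ} (hab : b ≤ a + 2 * π) {g : Circle → ℝ≥0∞}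
    (hg : Measurable g) :
    ∫⁻ ζ in Circle.exp '' Ioo a b, g ζ ∂circleArcLength =
      ∫⁻ θ in Ioo a b, g (Circle.exp θ) := by
  have hJ : MeasurableSet (Circle.exp '' Ioo a b) :=
    (isLocalHomeomorph_circleExp.isOpenMap _ isOpen_Ioo).measurableSet
  have hsub : Ioo a b ⊆ Ioc a (a + 2 * π) := fun x hx ↦ ⟨hx.1, hx.2.le.trans hab⟩
  have hpre : Circle.exp ⁻¹' (Circle.exp '' Ioo a b) ∩ Ioc a (a + 2 * π) = Ioo a b := by
    refine Subset.antisymm ?_ fun θ hθ ↦ ⟨mem_image_of_mem _ hθ, hsub hθ⟩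
    rintro θ ⟨⟨t, ht, hexp⟩, hθ⟩
    rwa [← Circle.exp_injOn_Ioc (by linarith : a + 2 * π - a ≤ 2 * π) (hsub ht) hθ hexp]
  have hexp := Circle.exp.continuous.measurable
  rw [circleArcLength_eq_map a, setLIntegral_map hJ hg hexp, Measure.restrict_restrict (hexp hJ),
    hpre]

lemma circleArcLength_circleExp_image_Ioo {a b : ℝ} (hab : b ≤ a + 2 * π) :
    circleArcLength (Circle.exp '' Ioo a b) = ENNReal.ofReal (b - a) := by
  rw [← setLIntegral_one, setLIntegral_circleExp_image_Ioo hab measurable_const, setLIntegral_one,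
    Real.volume_Ioo]

lemma isOpen_of_mem_complementaryArcs {E J : Set Circle} (hE : IsClosed E)
    (hJ : J ∈ complementaryArcs E) : IsOpen J := by
  have : LocallyConnectedSpace Circle :=
    ChartedSpace.locallyConnectedSpace (EuclideanSpace ℝ (Fin 1)) Circle
  obtain ⟨x, -, rfl⟩ := hJ
  exact hE.isOpen_compl.connectedComponentIn

lemma pairwiseDisjoint_complementaryArcs (E : Set Circle) :
    (complementaryArcs E).PairwiseDisjoint id := by
  rintro _ ⟨x, -, rfl⟩ _ ⟨y, -, rfl⟩ hne
  refine Set.disjoint_left.2 fun z hzx hzy ↦ hne ?_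
  exact (connectedComponentIn_eq hzx).trans (connectedComponentIn_eq hzy).symm

lemma nonempty_of_mem_complementaryArcs {E J : Set Circle} (hJ : J ∈ complementaryArcs E) :
    J.Nonempty := by
  obtain ⟨x, hx, rfl⟩ := hJ
  exact ⟨x, mem_connectedComponentIn hx⟩

lemma countable_complementaryArcs {E : Set Circle} (hE : IsClosed E) :
    (complementaryArcs E).Countable :=
  (pairwiseDisjoint_complementaryArcs E).countable_of_isOpen
    (fun _ hJ ↦ isOpen_of_mem_complementaryArcs hE hJ)
    fun _ hJ ↦ nonempty_of_mem_complementaryArcs hJ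

lemma iUnion_complementaryArcs (E : Set Circle) : ⋃ J : complementaryArcs E, J.1 = Eᶜ := by
  ext x
  simp only [mem_iUnion]
  constructor
  · rintro ⟨⟨_, y, _, rfl⟩, hx⟩
    exact connectedComponentIn_subset _ _ hx
  · intro hx
    exact ⟨⟨connectedComponentIn Eᶜ x, x, hx, rfl⟩, mem_connectedComponentIn hx⟩

lemma setLIntegral_compl_eq_tsum_complementaryArcs {E : Set Circle} (hE : IsClosed E)
    (μ : Measure Circle) (g : Circle → ℝ≥0∞) :
    ∫⁻ ζ in Eᶜ, g ζ ∂μ = ∑' J : complementaryArcs E, ∫⁻ ζ in J.1, g ζ ∂μ := by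
  have := (countable_complementaryArcs hE).to_subtype
  rw [← iUnion_complementaryArcs, lintegral_iUnion
    (fun J ↦ (isOpen_of_mem_complementaryArcs hE J.2).measurableSet)]
  exact fun J K hJK ↦ pairwiseDisjoint_complementaryArcs E J.2 K.2 (Subtype.coe_ne_coe.2 hJK)

/-! ### Beurling–Carleson sets and integrability of negative powers of the distance -/

lemma ennreal_rpow_neg_antitone {p : ℝ} (hp : 0 ≤ p) : Antitone fun x : ℝ≥0∞ ↦ x ^ (-p) := by
  intro x y hxy
  simp only [ENNReal.rpow_neg]
  gcongr

lemma setLIntegral_Ioo_sub_left_rpow_neg {a b p : ℝ} (hab : a ≤ b) (hp : p < 1) :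
    ∫⁻ θ in Ioo a b, ENNReal.ofReal ((θ - a) ^ (-p)) =
      ENNReal.ofReal ((b - a) ^ (1 - p) / (1 - p)) := by
  have hint : IntervalIntegrable (fun x : ℝ ↦ (x - a) ^ (-p)) volume a b := by
    simpa using (intervalIntegral.intervalIntegrable_rpow' (a := 0) (b := b - a)
      (by linarith : -1 < -p)).comp_sub_right a
  rw [← ofReal_integral_eq_lintegral_ofReal, ← integral_Ioc_eq_integral_Ioo,
    ← intervalIntegral.integral_of_le hab,
    intervalIntegral.integral_comp_sub_right (fun x ↦ x ^ (-p)) a, sub_self,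
    integral_rpow (Or.inl (by linarith)), neg_add_eq_sub, Real.zero_rpow (by linarith), sub_zero]
  · exact ((intervalIntegrable_iff_integrableOn_Ioc_of_le hab).1 hint).mono_set
      Ioo_subset_Ioc_self
  · filter_upwards [ae_restrict_mem measurableSet_Ioo] with x hx
    exact Real.rpow_nonneg (by linarith [hx.1]) _

lemma setLIntegral_Ioo_sub_right_rpow_neg {a b p : ℝ} (hab : a ≤ b) (hp : p < 1) :
    ∫⁻ θ in Ioo a b, ENNReal.ofReal ((b - θ) ^ (-p)) =
      ENNReal.ofReal ((b - a) ^ (1 - p) / (1 - p)) := by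
  have hreflect := (Measure.measurePreserving_sub_left volume (a + b)).setLIntegral_comp_preimage
    (s := Ioo a b) measurableSet_Ioo (f := fun θ ↦ ENNReal.ofReal ((θ - a) ^ (-p))) (by fun_prop)
  rw [← setLIntegral_Ioo_sub_left_rpow_neg hab hp, ← hreflect]
  rw [preimage_const_sub_Ioo, add_sub_cancel_left, add_sub_cancel_right]
  simp_rw [show ∀ θ, a + b - θ - a = b - θ by intro θ; ring]

lemma setLIntegral_Ioo_min_rpow_neg_le {a b p : ℝ} (hab : a ≤ b) (hp : p < 1) :
    ∫⁻ θ in Ioo a b, ENNReal.ofReal (min (θ - a) (b - θ) ^ (-p)) ≤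
      ENNReal.ofReal (2 / (1 - p)) * ENNReal.ofReal (b - a) ^ (1 - p) := by
  have hp' : 0 < 1 - p := by linarith
  have hab' : 0 ≤ b - a := by linarith
  calc _ ≤ ∫⁻ θ in Ioo a b,
        (ENNReal.ofReal ((θ - a) ^ (-p)) + ENNReal.ofReal ((b - θ) ^ (-p))) := by
        gcongr with θ
        rcases min_choice (θ - a) (b - θ) with h | h <;> rw [h]
        · exact le_self_add
        · exact le_add_self
    _ = _ := by
        rw [lintegral_add_left (by fun_prop), setLIntegral_Ioo_sub_left_rpow_neg hab hp,
          setLIntegral_Ioo_sub_right_rpow_neg hab hp, ENNReal.ofReal_rpow_of_nonneg hab' hp'.le,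
          ← ENNReal.ofReal_add (by positivity) (by positivity),
          ← ENNReal.ofReal_mul (by positivity)]
        congr 1
        ring

lemma le_infEDist_circleExp {a b : ℝ} {E : Set Circle} (hE : Disjoint (Ioo a b) (Circle.exp ⁻¹' E))
    (θ : ℝ) :
    ENNReal.ofReal (2 / π * min (θ - a) (b - θ)) ≤ infEDist (Circle.exp θ) E := by
  refine le_infEDist.2 fun ξ hξ ↦ ?_
  obtain ⟨ψ, rfl⟩ := Circle.exp_surjective ξ
  obtain ⟨φ, hφ, hψφ⟩ := Circle.periodic_exp.exists_mem_Ico (by positivity) ψ (θ - π)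
  rw [hψφ] at hξ ⊢
  rw [edist_dist]
  refine ENNReal.ofReal_le_ofReal (le_trans ?_
    (le_dist_circleExp (abs_le.2 ⟨by linarith [hφ.2], by linarith [hφ.1]⟩)))
  gcongr
  have hφ_notMem : φ ≤ a ∨ b ≤ φ := by
    by_contra! h
    exact Set.disjoint_left.1 hE h hξ
  rcases hφ_notMem with h | h
  · exact (min_le_left _ _).trans (le_abs.2 (Or.inl (by linarith)))
  · exact (min_le_right _ _).trans (le_abs.2 (Or.inr (by linarith)))

lemma setLIntegral_infEDist_rpow_neg_le {a b p : ℝ} (hab : b ≤ a + 2 * π) (hp₀ : 0 ≤ p)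
    (hp : p < 1) {E : Set Circle} (hE : Disjoint (Ioo a b) (Circle.exp ⁻¹' E)) :
    ∫⁻ ζ in Circle.exp '' Ioo a b, infEDist ζ E ^ (-p) ∂circleArcLength ≤
      ENNReal.ofReal ((2 / π) ^ (-p)) * ENNReal.ofReal (2 / (1 - p)) *
        circleArcLength (Circle.exp '' Ioo a b) ^ (1 - p) := by
  rcases le_or_gt b a with hba | hlt
  · simp [Ioo_eq_empty_of_le hba]
  rw [setLIntegral_circleExp_image_Ioo hab (by fun_prop), circleArcLength_circleExp_image_Ioo hab,
    mul_assoc]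
  calc ∫⁻ θ in Ioo a b, infEDist (Circle.exp θ) E ^ (-p)
      ≤ ∫⁻ θ in Ioo a b, ENNReal.ofReal ((2 / π) ^ (-p)) *
          ENNReal.ofReal (min (θ - a) (b - θ) ^ (-p)) := by
        refine setLIntegral_mono' measurableSet_Ioo fun θ hθ ↦ ?_
        have hmin : 0 < min (θ - a) (b - θ) := lt_min (by linarith [hθ.1]) (by linarith [hθ.2])
        rw [← ENNReal.ofReal_mul (by positivity), ← Real.mul_rpow (by positivity) hmin.le,
          ← ENNReal.ofReal_rpow_of_pos (by positivity)]
        exact ennreal_rpow_neg_antitone hp₀ (le_infEDist_circleExp hE θ)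
    _ ≤ _ := by
        rw [lintegral_const_mul' _ _ ENNReal.ofReal_ne_top]
        gcongr
        exact setLIntegral_Ioo_min_rpow_neg_le hlt.le hp

lemma rpow_circleArcLength_le_setLIntegral_infEDist {a b p : ℝ} (hab : b ≤ a + 2 * π)
    (hp₀ : 0 ≤ p) (hlt : a < b) {E : Set Circle} (ha : Circle.exp a ∈ E) :
    circleArcLength (Circle.exp '' Ioo a b) ^ (1 - p) ≤
      ∫⁻ ζ in Circle.exp '' Ioo a b, infEDist ζ E ^ (-p) ∂circleArcLength := by
  rw [setLIntegral_circleExp_image_Ioo hab (by fun_prop), circleArcLength_circleExp_image_Ioo hab]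
  have hL : ENNReal.ofReal (b - a) ≠ 0 := by simpa using hlt
  calc ENNReal.ofReal (b - a) ^ (1 - p)
      = ∫⁻ _ in Ioo a b, ENNReal.ofReal (b - a) ^ (-p) := by
        rw [setLIntegral_const, Real.volume_Ioo, show 1 - p = -p + 1 by ring,
          ENNReal.rpow_add _ _ hL ENNReal.ofReal_ne_top, ENNReal.rpow_one]
    _ ≤ _ := by
        refine setLIntegral_mono' measurableSet_Ioo fun θ hθ ↦ ennreal_rpow_neg_antitone hp₀ ?_
        refine (infEDist_le_edist_of_mem ha).trans ?_
        rw [edist_dist]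
        refine ENNReal.ofReal_le_ofReal ((dist_circleExp_le _ _).trans ?_)
        exact abs_le.2 ⟨by linarith [hθ.1], by linarith [hθ.2]⟩

lemma IsBeurlingCarleson.lintegral_infEDist_rpow_neg_lt_top {p : ℝ} (hp₀ : 0 ≤ p) (hp : p < 1)
    {E : Set Circle} (hE : IsBeurlingCarleson (1 - p) E) (hne : E.Nonempty) :
    ∫⁻ ζ, infEDist ζ E ^ (-p) ∂circleArcLength < ∞ := by
  have hrestrict : circleArcLength.restrict Eᶜ = circleArcLength :=
    Measure.restrict_eq_self_of_ae_mem (measure_eq_zero_iff_ae_notMem.1 hE.length_eq_zero)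
  rw [← hrestrict, setLIntegral_compl_eq_tsum_complementaryArcs hE.isClosed]
  calc _ ≤ ∑' J : complementaryArcs E, ENNReal.ofReal ((2 / π) ^ (-p)) *
        ENNReal.ofReal (2 / (1 - p)) * circleArcLength J.1 ^ (1 - p) := by
        refine ENNReal.tsum_le_tsum fun J ↦ ?_
        obtain ⟨a, b, hab, hJ, -, hdisj⟩ := exists_eq_circleExp_image_Ioo hE.isClosed hne J.2
        rw [hJ]
        exact setLIntegral_infEDist_rpow_neg_le hab hp₀ hp hdisj
    _ < ∞ := by
        rw [ENNReal.tsum_mul_left]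
        exact ENNReal.mul_lt_top (ENNReal.mul_lt_top ENNReal.ofReal_lt_top ENNReal.ofReal_lt_top)
          hE.sum_lt_top

lemma IsBeurlingCarleson.of_lintegral_infEDist_rpow_neg_lt_top {p : ℝ} (hp₀ : 0 < p)
    {E : Set Circle} (hE : IsClosed E) (hne : E.Nonempty)
    (h : ∫⁻ ζ, infEDist ζ E ^ (-p) ∂circleArcLength < ∞) : IsBeurlingCarleson (1 - p) E where
  isClosed := hE
  length_eq_zero := by
    refine measure_mono_null (fun ζ hζ ↦ ?_) (ae_lt_top (by fun_prop) h.ne)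
    simp [infEDist_zero_of_mem hζ, hp₀]
  sum_lt_top := by
    calc _ ≤ ∑' J : complementaryArcs E, ∫⁻ ζ in J.1, infEDist ζ E ^ (-p) ∂circleArcLength := by
          refine ENNReal.tsum_le_tsum fun J ↦ ?_
          obtain ⟨a, b, hab, hJ, ha, -⟩ := exists_eq_circleExp_image_Ioo hE hne J.2
          have hlt : a < b := nonempty_Ioo.1 <| image_nonempty.1 <|
            hJ ▸ nonempty_of_mem_complementaryArcs J.2
          rw [hJ]
          exact rpow_circleArcLength_le_setLIntegral_infEDist hab hp₀.le hlt ha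
      _ = ∫⁻ ζ in Eᶜ, infEDist ζ E ^ (-p) ∂circleArcLength :=
          (setLIntegral_compl_eq_tsum_complementaryArcs hE _ _).symm
      _ ≤ ∫⁻ ζ, infEDist ζ E ^ (-p) ∂circleArcLength := setLIntegral_le_lintegral _ _
      _ < ∞ := h

/-! ### The inverse square potential and the singular inner function -/

/-- The inverse square potential `V_μ(z) = ∫ |ξ - z|⁻² dμ(ξ)`, the quantity through which both
`|S_μ|` and `|S_μ'|` are controlled. It is `ℝ≥0∞`-valued, so that it makes sense on the circle. -/
noncomputable def inverseSquarePotential (μ : Measure Circle) (z : ℂ) : ℝ≥0∞ :=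
  ∫⁻ ξ : Circle, (‖(ξ : ℂ) - z‖ₑ ^ 2)⁻¹ ∂μ

lemma one_sub_norm_le_norm_circle_sub (ξ : Circle) (z : ℂ) : 1 - ‖z‖ ≤ ‖(ξ : ℂ) - z‖ := by
  simpa only [Circle.norm_coe] using norm_sub_norm_le (ξ : ℂ) z

lemma circle_sub_ne_zero (ξ : Circle) {z : ℂ} (hz : ‖z‖ < 1) : (ξ : ℂ) - z ≠ 0 := by
  have := one_sub_norm_le_norm_circle_sub ξ z
  exact norm_pos_iff.1 (by linarith)

lemma norm_ofReal_mul_circle {r : ℝ} (hr : 0 ≤ r) (ζ : Circle) : ‖(r : ℂ) * ζ‖ = r := by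
  rw [norm_mul, Circle.norm_coe, Complex.norm_real, Real.norm_of_nonneg hr, mul_one]

lemma norm_ofReal_mul_circle_lt_one {r : ℝ} (hr₀ : 0 ≤ r) (hr : r < 1) (ζ : Circle) :
    ‖(r : ℂ) * ζ‖ < 1 := by
  rwa [norm_ofReal_mul_circle hr₀]

lemma norm_ofReal_mul_circle_sub {r : ℝ} (hr : r ≤ 1) (ζ : Circle) :
    ‖(r : ℂ) * ζ - ζ‖ = 1 - r := by
  rw [norm_sub_rev, show (ζ : ℂ) - r * ζ = ((1 - r : ℝ) : ℂ) * ζ by push_cast; ring,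
    norm_ofReal_mul_circle (by linarith)]

lemma norm_circle_sub_le_two_mul (ξ ζ : Circle) {r : ℝ} (hr₀ : 0 ≤ r) (hr : r ≤ 1) :
    ‖(ξ : ℂ) - ζ‖ ≤ 2 * ‖(ξ : ℂ) - r * ζ‖ := by
  have h₁ := one_sub_norm_le_norm_circle_sub ξ (r * ζ)
  rw [norm_ofReal_mul_circle hr₀] at h₁
  have h₂ := norm_sub_le_norm_sub_add_norm_sub (ξ : ℂ) (r * ζ) ζ
  rw [norm_ofReal_mul_circle_sub hr] at h₂
  linarith

section Potential

variable (μ : Measure Circle)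

lemma inverseSquarePotential_mono {μ ν : Measure Circle} (h : μ ≤ ν) (z : ℂ) :
    inverseSquarePotential μ z ≤ inverseSquarePotential ν z :=
  lintegral_mono' h le_rfl

lemma measurable_inverseSquarePotential [SFinite μ] : Measurable (inverseSquarePotential μ) := by
  have hm : Measurable fun q : ℂ × Circle ↦ (‖(q.2 : ℂ) - q.1‖ₑ ^ 2)⁻¹ := by fun_prop
  exact hm.lintegral_prod_right'

lemma measurable_inverseSquarePotential_circle [SFinite μ] :
    Measurable fun ζ : Circle ↦ inverseSquarePotential μ ζ :=
  (measurable_inverseSquarePotential μ).comp (Continuous.measurable (by fun_prop))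

variable {μ}

lemma inverseSquarePotential_le_four_mul {z w : ℂ} (h : ∀ᵐ ξ : Circle ∂μ, ‖z - w‖ ≤ ‖(ξ : ℂ) - z‖) :
    inverseSquarePotential μ z ≤ 4 * inverseSquarePotential μ w := by
  rw [inverseSquarePotential, inverseSquarePotential, ← lintegral_const_mul' _ _ (by simp)]
  refine lintegral_mono_ae (h.mono fun ξ hξ ↦ ?_)
  have hle : ‖(ξ : ℂ) - w‖ₑ ≤ 2 * ‖(ξ : ℂ) - z‖ₑ := by
    rw [two_mul, ← sub_add_sub_cancel (ξ : ℂ) z w]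
    exact (enorm_add_le _ _).trans (add_le_add le_rfl (enorm_le_iff_norm_le.2 hξ))
  calc (‖(ξ : ℂ) - z‖ₑ ^ 2)⁻¹ = 4 * ((2 * ‖(ξ : ℂ) - z‖ₑ) ^ 2)⁻¹ := by
        rw [mul_pow, ENNReal.mul_inv (by simp) (by simp), ← mul_assoc,
          show (2 : ℝ≥0∞) ^ 2 = 4 by norm_num, ENNReal.mul_inv_cancel (by simp) (by simp), one_mul]
    _ ≤ 4 * (‖(ξ : ℂ) - w‖ₑ ^ 2)⁻¹ := by gcongr

variable (μ)

lemma inverseSquarePotential_le_four_mul_of_norm_sub_le {z w : ℂ} (h : ‖z - w‖ ≤ 1 - ‖z‖) :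
    inverseSquarePotential μ z ≤ 4 * inverseSquarePotential μ w :=
  inverseSquarePotential_le_four_mul <|
    ae_of_all _ fun ξ ↦ h.trans (one_sub_norm_le_norm_circle_sub ξ z)

lemma inverseSquarePotential_radial_le (ζ : Circle) {r : ℝ} (hr₀ : 0 ≤ r) (hr : r ≤ 1) :
    inverseSquarePotential μ (r * ζ) ≤ 4 * inverseSquarePotential μ ζ := by
  refine inverseSquarePotential_le_four_mul_of_norm_sub_le μ ?_
  rw [norm_ofReal_mul_circle_sub hr, norm_ofReal_mul_circle hr₀]

variable {μ} in
lemma inverseSquarePotential_eq_lintegral_ofReal {z : ℂ} (h : ∀ᵐ ξ : Circle ∂μ, (ξ : ℂ) ≠ z) :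
    inverseSquarePotential μ z = ∫⁻ ξ : Circle, ENNReal.ofReal ((‖(ξ : ℂ) - z‖ ^ 2)⁻¹) ∂μ := by
  refine lintegral_congr_ae ?_
  filter_upwards [h] with ξ hξ
  have : 0 < ‖(ξ : ℂ) - z‖ := norm_pos_iff.2 (sub_ne_zero.2 hξ)
  rw [ENNReal.ofReal_inv_of_pos (by positivity), ENNReal.ofReal_pow (norm_nonneg _), ofReal_norm]

section LtTop

variable {μ} {z : ℂ} (hV : inverseSquarePotential μ z < ∞)
include hV

lemma ae_circle_ne_of_inverseSquarePotential_lt_top : ∀ᵐ ξ : Circle ∂μ, (ξ : ℂ) ≠ z := by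
  filter_upwards [ae_lt_top (by fun_prop) hV.ne] with ξ hξ h
  simp [h] at hξ

lemma integrable_inv_norm_circle_sub_sq :
    Integrable (fun ξ : Circle ↦ (‖(ξ : ℂ) - z‖ ^ 2)⁻¹) μ := by
  refine ⟨Measurable.aestronglyMeasurable (by fun_prop), ?_⟩
  rwa [hasFiniteIntegral_iff_ofReal (ae_of_all _ fun ξ ↦ by positivity),
    ← inverseSquarePotential_eq_lintegral_ofReal (ae_circle_ne_of_inverseSquarePotential_lt_top hV)]

lemma inverseSquarePotential_eq_ofReal_integral :
    inverseSquarePotential μ z = ENNReal.ofReal (∫ ξ : Circle, (‖(ξ : ℂ) - z‖ ^ 2)⁻¹ ∂μ) := by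
  rw [ofReal_integral_eq_lintegral_ofReal (integrable_inv_norm_circle_sub_sq hV)
    (ae_of_all _ fun ξ ↦ by positivity)]
  exact inverseSquarePotential_eq_lintegral_ofReal
    (ae_circle_ne_of_inverseSquarePotential_lt_top hV)

end LtTop

variable [IsFiniteMeasure μ] {z : ℂ}

lemma inverseSquarePotential_lt_top (hz : ‖z‖ < 1) : inverseSquarePotential μ z < ∞ :=
  calc inverseSquarePotential μ z ≤ ∫⁻ _, (ENNReal.ofReal (1 - ‖z‖) ^ 2)⁻¹ ∂μ := by
        refine lintegral_mono fun ξ ↦ ?_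
        rw [← ofReal_norm]
        gcongr
        exact one_sub_norm_le_norm_circle_sub ξ z
    _ < ∞ := by
        rw [lintegral_const]
        refine ENNReal.mul_lt_top (ENNReal.inv_lt_top.2 (ENNReal.pow_pos ?_ 2)) (measure_lt_top _ _)
        exact ENNReal.ofReal_pos.2 (sub_pos.2 hz)

lemma integrable_herglotz (hz : ‖z‖ < 1) :
    Integrable (fun ξ : Circle ↦ ((ξ : ℂ) + z) / (ξ - z)) μ := by
  have hc : Continuous fun ξ : Circle ↦ ((ξ : ℂ) + z) / (ξ - z) :=
    Continuous.div (by fun_prop) (by fun_prop) fun ξ ↦ circle_sub_ne_zero ξ hz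
  exact hc.integrable_of_hasCompactSupport (.of_compactSpace _)

lemma re_herglotz (ξ : Circle) (z : ℂ) :
    (((ξ : ℂ) + z) / (ξ - z)).re = (1 - ‖z‖ ^ 2) * (‖(ξ : ℂ) - z‖ ^ 2)⁻¹ := by
  have h := congrFun (poissonKernel_eq_re_herglotzRieszKernel (c := 0) (w := z)) (ξ : ℂ)
  simp only [Function.comp_apply, poissonKernel_def, herglotzRieszKernel_def, sub_zero,
    Circle.norm_coe] at h
  rw [← h]
  simp [div_eq_mul_inv]

lemma norm_singularInner (hz : ‖z‖ < 1) :
    ‖singularInner μ z‖ =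
      Real.exp (-((1 - ‖z‖ ^ 2) * (inverseSquarePotential μ z).toReal)) := by
  rw [singularInner, Complex.norm_exp, Complex.neg_re,
    inverseSquarePotential_eq_ofReal_integral (inverseSquarePotential_lt_top μ hz),
    ENNReal.toReal_ofReal (integral_nonneg fun ξ ↦ by positivity), ← integral_const_mul]
  congr 2
  rw [← RCLike.re_eq_complex_re, ← integral_re (integrable_herglotz μ hz)]
  exact integral_congr_ae (ae_of_all _ fun ξ ↦ re_herglotz ξ z)

lemma norm_singularInner_le_one (hz : ‖z‖ < 1) : ‖singularInner μ z‖ ≤ 1 := by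
  rw [norm_singularInner μ hz, Real.exp_le_one_iff, neg_nonpos]
  have : 0 ≤ 1 - ‖z‖ ^ 2 := by nlinarith [norm_nonneg z]
  positivity

lemma hasDerivAt_integral_herglotz (hz : ‖z‖ < 1) :
    HasDerivAt (fun w ↦ ∫ ξ : Circle, ((ξ : ℂ) + w) / (ξ - w) ∂μ)
      (∫ ξ : Circle, 2 * (ξ : ℂ) / (ξ - z) ^ 2 ∂μ) z := by
  set ε := (1 - ‖z‖) / 2 with hε
  have hε₀ : 0 < ε := by linarith
  have hball (w : ℂ) (hw : w ∈ ball z ε) : ‖w‖ < 1 - ε := by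
    rw [mem_ball, dist_eq_norm] at hw
    linarith [norm_sub_norm_le w z]
  have hball_lt (w : ℂ) (hw : w ∈ ball z ε) : ‖w‖ < 1 := by linarith [hball w hw]
  have hderiv_cont : Continuous fun ξ : Circle ↦ 2 * (ξ : ℂ) / (ξ - z) ^ 2 :=
    Continuous.div (by fun_prop) (by fun_prop) fun ξ ↦ pow_ne_zero _ (circle_sub_ne_zero ξ hz)
  have hbound (ξ : Circle) (w : ℂ) (hw : w ∈ ball z ε) :
      ‖2 * (ξ : ℂ) / (ξ - w) ^ 2‖ ≤ 2 / ε ^ 2 := by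
    simp only [norm_div, norm_mul, norm_pow, Circle.norm_coe, Complex.norm_ofNat, mul_one]
    gcongr
    linarith [hball w hw, one_sub_norm_le_norm_circle_sub ξ w]
  have hderiv (ξ : Circle) (w : ℂ) (hw : w ∈ ball z ε) :
      HasDerivAt (fun w : ℂ ↦ ((ξ : ℂ) + w) / (ξ - w)) (2 * (ξ : ℂ) / (ξ - w) ^ 2) w := by
    refine (((hasDerivAt_id' w).const_add (ξ : ℂ)).div ((hasDerivAt_id' w).const_sub (ξ : ℂ))
      (circle_sub_ne_zero ξ (hball_lt w hw))).congr_deriv ?_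
    ring
  exact (hasDerivAt_integral_of_dominated_loc_of_deriv_le (ball_mem_nhds z hε₀)
    (eventually_of_mem (ball_mem_nhds z hε₀) fun w hw ↦
      (integrable_herglotz μ (hball_lt w hw)).aestronglyMeasurable)
    (integrable_herglotz μ hz) hderiv_cont.aestronglyMeasurable (ae_of_all _ hbound)
    (integrable_const _) (ae_of_all _ hderiv)).2

lemma hasDerivAt_singularInner (hz : ‖z‖ < 1) :
    HasDerivAt (singularInner μ)
      (-(singularInner μ z * ∫ ξ : Circle, 2 * (ξ : ℂ) / (ξ - z) ^ 2 ∂μ)) z := by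
  rw [← mul_neg]
  exact (hasDerivAt_integral_herglotz μ hz).neg.cexp

lemma differentiableOn_singularInner : DifferentiableOn ℂ (singularInner μ) (ball 0 1) :=
  fun _ hz ↦ (hasDerivAt_singularInner μ
    (mem_ball_zero_iff.1 hz)).differentiableAt.differentiableWithinAt

lemma enorm_deriv_singularInner_le (hz : ‖z‖ < 1) :
    ‖deriv (singularInner μ) z‖ₑ ≤ 2 * inverseSquarePotential μ z := by
  rw [(hasDerivAt_singularInner μ hz).deriv, enorm_neg, enorm_mul, inverseSquarePotential]
  have hS : ‖singularInner μ z‖ₑ ≤ 1 := by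
    simpa using enorm_le_iff_norm_le.2
      ((norm_singularInner_le_one μ hz).trans_eq (norm_one (α := ℂ)).symm)
  calc _ ≤ 1 * ∫⁻ ξ : Circle, ‖2 * (ξ : ℂ) / (ξ - z) ^ 2‖ₑ ∂μ := by
        gcongr
        exact enorm_integral_le_lintegral_enorm _
    _ = _ := by
        rw [one_mul, ← lintegral_const_mul' _ _ (by simp)]
        refine lintegral_congr fun ξ ↦ ?_
        have hξ : ‖(ξ : ℂ)‖ₑ = 1 := by rw [← ofReal_norm, Circle.norm_coe, ENNReal.ofReal_one]
        have h₂ : ‖(2 : ℂ)‖ₑ = 2 := by simp [← ofReal_norm]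
        rw [div_eq_mul_inv, enorm_mul, enorm_mul,
          enorm_inv (pow_ne_zero _ (circle_sub_ne_zero ξ hz)), enorm_pow, hξ, h₂, mul_one]

lemma exp_neg_le_norm_singularInner_radial {ζ : Circle} (hV : inverseSquarePotential μ ζ ≠ ∞)
    {r : ℝ} (hr₀ : 0 ≤ r) (hr : r < 1) :
    Real.exp (-(8 * (1 - r) * (inverseSquarePotential μ ζ).toReal)) ≤
      ‖singularInner μ (r * ζ)‖ := by
  have hz := norm_ofReal_mul_circle_lt_one hr₀ hr ζ
  have h := ENNReal.toReal_mono (ENNReal.mul_ne_top (by simp) hV)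
    (inverseSquarePotential_radial_le μ ζ hr₀ hr.le)
  rw [ENNReal.toReal_mul, ENNReal.toReal_ofNat] at h
  rw [norm_singularInner μ hz, norm_ofReal_mul_circle hr₀, Real.exp_le_exp, neg_le_neg_iff]
  calc (1 - r ^ 2) * (inverseSquarePotential μ (r * ζ)).toReal
      ≤ (2 * (1 - r)) * (4 * (inverseSquarePotential μ ζ).toReal) := by
        gcongr
        nlinarith
    _ = _ := by ring

/-- Away from the support of `μ` the potential does not drop along the radius, so `S_μ` is small
there when `V_μ` is large at the endpoint. -/
lemma norm_singularInner_radial_le_exp {ζ : Circle} {r : ℝ} (hr₀ : 0 ≤ r) (hr : r < 1)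
    (h : ∀ᵐ ξ : Circle ∂μ, 1 - r ≤ ‖(ξ : ℂ) - ζ‖) :
    ‖singularInner μ (r * ζ)‖ ≤
      Real.exp (-((1 - r) * (inverseSquarePotential μ ζ).toReal / 4)) := by
  have hz := norm_ofReal_mul_circle_lt_one hr₀ hr ζ
  have hV := ENNReal.toReal_mono
    (ENNReal.mul_ne_top (by simp) (inverseSquarePotential_lt_top μ hz).ne)
    (inverseSquarePotential_le_four_mul (z := ζ) (w := r * ζ) (μ := μ)
      (by simpa only [norm_sub_rev (ζ : ℂ), norm_ofReal_mul_circle_sub hr.le] using h))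
  rw [ENNReal.toReal_mul, ENNReal.toReal_ofNat] at hV
  rw [norm_singularInner μ hz, norm_ofReal_mul_circle hr₀, Real.exp_le_exp, neg_le_neg_iff]
  calc (1 - r) * (inverseSquarePotential μ ζ).toReal / 4
      = (1 - r) * ((inverseSquarePotential μ ζ).toReal / 4) := by ring
    _ ≤ (1 - r ^ 2) * (inverseSquarePotential μ (r * ζ)).toReal := by
        gcongr
        · nlinarith
        · nlinarith
        · linarith

end Potential

/-! ### The area condition along radii -/

/-- The contribution of the radius ending at `ζ` to the integral in the area condition for `S_μ`
at level `c`; the factor `r` is the Jacobian of polar coordinates. -/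
noncomputable def radialArea (s : ℝ) (μ : Measure Circle) (c : ℝ) (ζ : Circle) : ℝ≥0∞ :=
  ∫⁻ r in {r : ℝ | r ∈ Ioo 0 1 ∧ ‖singularInner μ (r * ζ)‖ < c},
    ENNReal.ofReal r * ENNReal.ofReal (1 / (1 - r) ^ s)

lemma isOpen_sublevel_singularInner (μ : Measure Circle) [IsFiniteMeasure μ] (c : ℝ) :
    IsOpen {z : ℂ | ‖z‖ < 1 ∧ ‖singularInner μ z‖ < c} := by
  convert (differentiableOn_singularInner μ).continuousOn.norm.isOpen_inter_preimage isOpen_ball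
    (isOpen_Iio (a := c)) using 1
  ext z
  simp

lemma setLIntegral_sublevel_eq (s : ℝ) (μ : Measure Circle) [IsFiniteMeasure μ] (c : ℝ) :
    ∫⁻ z in {z : ℂ | ‖z‖ < 1 ∧ ‖singularInner μ z‖ < c}, ENNReal.ofReal (1 / (1 - ‖z‖) ^ s) =
      ∫⁻ ζ, radialArea s μ c ζ ∂circleArcLength := by
  have hA := isOpen_sublevel_singularInner μ c
  rw [← lintegral_indicator hA.measurableSet,
    lintegral_polar (Measurable.indicator (by fun_prop) hA.measurableSet)]
  refine lintegral_congr fun ζ ↦ ?_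
  set A := {z : ℂ | ‖z‖ < 1 ∧ ‖singularInner μ z‖ < c}
  have hray : Continuous fun r : ℝ ↦ (r : ℂ) * ζ := by fun_prop
  set B := (fun r : ℝ ↦ (r : ℂ) * ζ) ⁻¹' A
  have hB : MeasurableSet B := hray.measurable hA.measurableSet
  have hset : B ∩ Ioi 0 =
      {r : ℝ | r ∈ Ioo 0 1 ∧ ‖singularInner μ (r * ζ)‖ < c} := by
    ext r
    simp only [A, B, mem_inter_iff, mem_preimage, mem_ofPred_eq, mem_Ioi, mem_Ioo]
    constructor
    · rintro ⟨⟨hr₁, hS⟩, hr₀⟩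
      exact ⟨⟨hr₀, by rwa [norm_ofReal_mul_circle hr₀.le] at hr₁⟩, hS⟩
    · rintro ⟨⟨hr₀, hr₁⟩, hS⟩
      exact ⟨⟨norm_ofReal_mul_circle_lt_one hr₀.le hr₁ ζ, hS⟩, hr₀⟩
  calc ∫⁻ r in Ioi (0 : ℝ), ENNReal.ofReal r *
        A.indicator (fun z : ℂ ↦ ENNReal.ofReal (1 / (1 - ‖z‖) ^ s)) (r * ζ)
      = ∫⁻ r in Ioi 0, B.indicator
          (fun r ↦ ENNReal.ofReal r * ENNReal.ofReal (1 / (1 - r) ^ s)) r := by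
        refine setLIntegral_congr_fun measurableSet_Ioi fun r hr ↦ ?_
        by_cases h : r ∈ B
        · rw [indicator_of_mem h, indicator_of_mem (s := A) h, norm_ofReal_mul_circle hr.le]
        · rw [indicator_of_notMem h, indicator_of_notMem (s := A) h, mul_zero]
    _ = radialArea s μ c ζ := by rw [setLIntegral_indicator hB, hset, radialArea]

lemma areaCondition_iff (s : ℝ) (μ : Measure Circle) [IsFiniteMeasure μ] :
    AreaCondition s μ ↔ ∀ c : ℝ, 0 < c → c < 1 →
      ∫⁻ ζ, radialArea s μ c ζ ∂circleArcLength < ∞ := by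
  simp_rw [AreaCondition, setLIntegral_sublevel_eq]

lemma ofReal_rpow_neg_le_setLIntegral_radial {p a : ℝ} (hp : 0 ≤ p) (ha : 0 < a)
    (ha' : a ≤ 1 / 4) {A : Set ℝ} (hA : Ioo (1 - 2 * a) (1 - a) ⊆ A) :
    ENNReal.ofReal (a ^ (-p)) ≤ ENNReal.ofReal (2 ^ (2 + p)) *
      ∫⁻ r in A, ENNReal.ofReal r * ENNReal.ofReal (1 / (1 - r) ^ (1 + p)) := by
  calc ENNReal.ofReal (a ^ (-p))
      = ENNReal.ofReal (2 ^ (2 + p)) *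
          ENNReal.ofReal (1 / 2 * (1 / (2 * a) ^ (1 + p)) * a) := by
        rw [← ENNReal.ofReal_mul (by positivity), Real.mul_rpow (by norm_num) ha.le,
          show 2 + p = 1 + (1 + p) by ring, Real.rpow_add (by norm_num : (0 : ℝ) < 2) 1,
          Real.rpow_add ha, Real.rpow_neg ha.le, Real.rpow_one, Real.rpow_one]
        congr 1
        field_simp
    _ = ENNReal.ofReal (2 ^ (2 + p)) * ∫⁻ _ in Ioo (1 - 2 * a) (1 - a),
          ENNReal.ofReal (1 / 2 * (1 / (2 * a) ^ (1 + p))) := by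
        rw [setLIntegral_const, Real.volume_Ioo, ENNReal.ofReal_mul (by positivity)]
        ring_nf
    _ ≤ _ := by
        refine mul_le_mul_right (le_trans ?_ (lintegral_mono_set hA)) _
        refine setLIntegral_mono' measurableSet_Ioo fun r ⟨hr, hr'⟩ ↦ ?_
        rw [← ENNReal.ofReal_mul (by linarith)]
        have : 0 < 1 - r := by linarith
        gcongr <;> linarith

lemma setLIntegral_radial_le_ofReal_rpow_neg {p a : ℝ} (hp : 0 < p) (ha : 0 < a) {A : Set ℝ}
    (hA : A ⊆ Ioc 0 (1 - a)) :
    ∫⁻ r in A, ENNReal.ofReal r * ENNReal.ofReal (1 / (1 - r) ^ (1 + p)) ≤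
      ENNReal.ofReal (a ^ (-p) / p) := by
  rcases le_or_gt 1 a with ha₁ | ha₁
  · have : A = ∅ := subset_empty_iff.1 (hA.trans (Ioc_eq_empty (by linarith)).subset)
    simp [this]
  have h₀ : (0 : ℝ) ∉ uIcc a 1 := by
    rw [uIcc_of_le ha₁.le]
    exact fun h ↦ ha.not_ge h.1
  have hint : IntervalIntegrable (fun r : ℝ ↦ (1 - r) ^ (-(1 + p))) volume 0 (1 - a) := by
    simpa using ((intervalIntegral.intervalIntegrable_rpow (μ := volume) (r := -(1 + p))
      (Or.inr h₀)).comp_sub_left 1).symm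
  calc _ ≤ ∫⁻ r in Ioc 0 (1 - a), ENNReal.ofReal ((1 - r) ^ (-(1 + p))) := by
        refine (lintegral_mono_set hA).trans
          (setLIntegral_mono' measurableSet_Ioc fun r ⟨_, _⟩ ↦ ?_)
        rw [Real.rpow_neg (by linarith), one_div]
        exact mul_le_of_le_one_left zero_le (ENNReal.ofReal_le_one.2 (by linarith))
    _ = ENNReal.ofReal ((a ^ (-p) - 1) / p) := by
        rw [← ofReal_integral_eq_lintegral_ofReal, ← intervalIntegral.integral_of_le (by linarith),
          intervalIntegral.integral_comp_sub_left (fun x ↦ x ^ (-(1 + p))) 1, sub_sub_cancel,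
          sub_zero, integral_rpow (Or.inr ⟨by linarith, h₀⟩), Real.one_rpow,
          show -(1 + p) + 1 = -p by ring, div_neg, ← neg_div, neg_sub]
        · exact (intervalIntegrable_iff_integrableOn_Ioc_of_le (by linarith)).1 hint
        · filter_upwards [ae_restrict_mem measurableSet_Ioc] with r ⟨_, _⟩
          exact Real.rpow_nonneg (by linarith) _
    _ ≤ _ := by
        gcongr
        linarith

/-! ### Integrability of the potential, the area condition and the Hardy space -/

lemma radialArea_le_rpow_inverseSquarePotential {p : ℝ} (hp : 0 < p) (μ : Measure Circle)
    [IsFiniteMeasure μ] {c : ℝ} (hc₀ : 0 < c) (hc : c < 1) {ζ : Circle}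
    (hV : inverseSquarePotential μ ζ ≠ ∞) :
    radialArea (1 + p) μ c ζ ≤
      ENNReal.ofReal ((8 / -Real.log c) ^ p / p) * inverseSquarePotential μ ζ ^ p := by
  set v := (inverseSquarePotential μ ζ).toReal with hv
  have hv₀ : 0 ≤ v := ENNReal.toReal_nonneg
  set t := -Real.log c
  have ht : 0 < t := neg_pos.2 (Real.log_neg hc₀ hc)
  have hlt {r : ℝ} (hr : r ∈ Ioo 0 1) (h : ‖singularInner μ (r * ζ)‖ < c) :
      t < 8 * (1 - r) * v := by
    have := (Real.lt_log_iff_exp_lt hc₀).2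
      ((exp_neg_le_norm_singularInner_radial μ hV hr.1.le hr.2).trans_lt h)
    linarith
  rcases hv₀.eq_or_lt' with hv_zero | hv_pos
  · have hempty : {r : ℝ | r ∈ Ioo 0 1 ∧ ‖singularInner μ (r * ζ)‖ < c} = ∅ := by
      refine eq_empty_of_forall_notMem fun r ⟨hr, h⟩ ↦ ht.not_gt ?_
      simpa only [hv_zero, mul_zero] using hlt hr h
    rw [radialArea, hempty]
    simp
  have hsub : {r : ℝ | r ∈ Ioo 0 1 ∧ ‖singularInner μ (r * ζ)‖ < c} ⊆
      Ioc 0 (1 - t / (8 * v)) := fun r ⟨hr, h⟩ ↦ by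
    have : t / (8 * v) ≤ 1 - r := by
      rw [div_le_iff₀ (by positivity)]
      linarith [hlt hr h]
    exact ⟨hr.1, by linarith⟩
  refine (setLIntegral_radial_le_ofReal_rpow_neg hp (by positivity) hsub).trans_eq ?_
  rw [← ENNReal.ofReal_toReal hV, ← hv, ENNReal.ofReal_rpow_of_pos hv_pos,
    ← ENNReal.ofReal_mul (by positivity), Real.rpow_neg (by positivity),
    ← Real.inv_rpow (by positivity), inv_div, mul_div_right_comm, Real.mul_rpow (by positivity) hv₀]
  ring_nf

lemma areaCondition_of_lintegral_potential_lt_top {p : ℝ} (hp : 0 < p) (μ : Measure Circle)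
    [IsFiniteMeasure μ]
    (h : ∫⁻ ζ : Circle, inverseSquarePotential μ ζ ^ p ∂circleArcLength < ∞) :
    AreaCondition (1 + p) μ := by
  refine (areaCondition_iff _ _).2 fun c hc₀ hc ↦ ?_
  calc _ ≤ ∫⁻ ζ : Circle, ENNReal.ofReal ((8 / -Real.log c) ^ p / p) *
        inverseSquarePotential μ ζ ^ p ∂circleArcLength := by
        refine lintegral_mono_ae ?_
        filter_upwards [ae_lt_top ((measurable_inverseSquarePotential_circle μ).pow_const p) h.ne]
          with ζ hζ
        exact radialArea_le_rpow_inverseSquarePotential hp μ hc₀ hc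
          (ENNReal.rpow_lt_top_iff_of_pos hp |>.1 hζ).ne
    _ < ∞ := by
        rw [lintegral_const_mul' _ _ ENNReal.ofReal_ne_top]
        exact ENNReal.mul_lt_top ENNReal.ofReal_lt_top h

lemma memHardy_deriv_of_lintegral_potential_lt_top {p : ℝ} (hp : 0 ≤ p) (μ : Measure Circle)
    [IsFiniteMeasure μ]
    (h : ∫⁻ ζ : Circle, inverseSquarePotential μ ζ ^ p ∂circleArcLength < ∞) :
    MemHardy p (deriv (singularInner μ)) := by
  have hC : (8 : ℝ≥0∞) ^ p < ∞ := ENNReal.rpow_lt_top_of_nonneg hp (by simp)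
  refine ⟨(differentiableOn_singularInner μ).deriv isOpen_ball,
    lt_of_le_of_lt (iSup_le fun r ↦ ?_) (ENNReal.mul_lt_top hC h)⟩
  rw [← lintegral_const_mul' _ _ hC.ne]
  refine lintegral_mono fun ζ ↦ ?_
  rw [← ENNReal.mul_rpow_of_nonneg _ _ hp]
  gcongr
  calc _ ≤ 2 * inverseSquarePotential μ ((r : ℝ) * ζ) :=
        enorm_deriv_singularInner_le μ (norm_ofReal_mul_circle_lt_one r.2.1 r.2.2 ζ)
    _ ≤ 2 * (4 * inverseSquarePotential μ ζ) := by
        gcongr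
        exact inverseSquarePotential_radial_le μ ζ r.2.1 r.2.2.le
    _ = 8 * inverseSquarePotential μ ζ := by
        rw [← mul_assoc]
        norm_num

lemma ae_infEDist_le_enorm_sub {μ : Measure Circle} {E : Set Circle} (hμ : μ Eᶜ = 0)
    (ζ : Circle) : ∀ᵐ ξ : Circle ∂μ, infEDist ζ E ≤ ‖(ξ : ℂ) - ζ‖ₑ := by
  filter_upwards [measure_eq_zero_iff_ae_notMem.1 hμ] with ξ hξ
  rw [← edist_circle_eq_enorm_sub, edist_comm]
  exact infEDist_le_edist_of_mem (not_notMem.1 hξ)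

lemma inverseSquarePotential_lt_top_of_notMem {μ : Measure Circle} [IsFiniteMeasure μ]
    {E : Set Circle} (hE : IsClosed E) (hμ : μ Eᶜ = 0) {ζ : Circle} (hζ : ζ ∉ E) :
    inverseSquarePotential μ ζ < ∞ := by
  have hd : infEDist ζ E ≠ 0 := by
    rwa [Ne, ← mem_closure_iff_infEDist_zero, hE.closure_eq]
  calc inverseSquarePotential μ ζ ≤ ∫⁻ _, (infEDist ζ E ^ 2)⁻¹ ∂μ := by
        refine lintegral_mono_ae ?_
        filter_upwards [ae_infEDist_le_enorm_sub hμ ζ] with ξ hξ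
        gcongr
    _ < ∞ := by
        rw [lintegral_const]
        exact ENNReal.mul_lt_top (by simp [hd, pos_iff_ne_zero]) (measure_lt_top _ _)

lemma rpow_inverseSquarePotential_le_radialArea {p : ℝ} (hp : 0 ≤ p) (μ : Measure Circle)
    [IsFiniteMeasure μ] {ζ : Circle} {v : ℝ} (hv : v = (inverseSquarePotential μ ζ).toReal)
    (hv_ge : 16 ≤ v) (hfar : ∀ᵐ ξ : Circle ∂μ, 8 / v ≤ ‖(ξ : ℂ) - ζ‖) :
    ENNReal.ofReal (v ^ p) ≤
      ENNReal.ofReal (4 ^ p * 2 ^ (2 + p)) * radialArea (1 + p) μ (Real.exp (-1)) ζ := by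
  have hv₀ : 0 < v := by linarith
  have ha : 4 / v ≤ 1 / 4 := by rw [div_le_div_iff₀ hv₀ (by norm_num)]; linarith
  have h8 : 2 * (4 / v) = 8 / v := by ring
  have hsub : Ioo (1 - 2 * (4 / v)) (1 - 4 / v) ⊆
      {r : ℝ | r ∈ Ioo 0 1 ∧ ‖singularInner μ (r * ζ)‖ < Real.exp (-1)} := fun r ⟨hr, hr'⟩ ↦ by
    have : 0 < 4 / v := by positivity
    have hr_gt : 4 < (1 - r) * v := (div_lt_iff₀ hv₀).1 (by linarith)
    refine ⟨⟨by linarith, by linarith⟩, ?_⟩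
    refine (norm_singularInner_radial_le_exp μ (by linarith) (by linarith)
      (hfar.mono fun ξ hξ ↦ le_trans (by linarith) hξ)).trans_lt ?_
    rw [← hv, Real.exp_lt_exp]
    linarith
  calc ENNReal.ofReal (v ^ p) = ENNReal.ofReal (4 ^ p) * ENNReal.ofReal ((4 / v) ^ (-p)) := by
        rw [← ENNReal.ofReal_mul (by positivity), Real.rpow_neg (by positivity),
          Real.div_rpow (by norm_num) hv₀.le, inv_div, mul_div_cancel₀ _ (by positivity)]
    _ ≤ ENNReal.ofReal (4 ^ p) * (ENNReal.ofReal (2 ^ (2 + p)) *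
          radialArea (1 + p) μ (Real.exp (-1)) ζ) := by
        gcongr
        exact ofReal_rpow_neg_le_setLIntegral_radial hp (by positivity) ha hsub
    _ = _ := by rw [← mul_assoc, ← ENNReal.ofReal_mul (by positivity)]

lemma rpow_inverseSquarePotential_le {p : ℝ} (hp : 0 ≤ p) (μ : Measure Circle)
    [IsFiniteMeasure μ] {E : Set Circle} (hE : IsClosed E) (hne : E.Nonempty) (hμ : μ Eᶜ = 0)
    {ζ : Circle} (hζ : ζ ∉ E) :
    inverseSquarePotential μ ζ ^ p ≤ 32 ^ p * infEDist ζ E ^ (-p) +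
      ENNReal.ofReal (4 ^ p * 2 ^ (2 + p)) * radialArea (1 + p) μ (Real.exp (-1)) ζ := by
  rcases le_or_gt (inverseSquarePotential μ ζ) (32 * (infEDist ζ E)⁻¹) with hle | hgt
  · refine le_trans ?_ le_self_add
    rw [ENNReal.rpow_neg, ← ENNReal.inv_rpow, ← ENNReal.mul_rpow_of_nonneg _ _ hp]
    gcongr
  refine le_trans ?_ le_add_self
  have hV := (inverseSquarePotential_lt_top_of_notMem hE hμ hζ).ne
  have hd_le : infEDist ζ E ≤ ENNReal.ofReal 2 := by
    obtain ⟨ξ, hξ⟩ := hne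
    refine (infEDist_le_edist_of_mem hξ).trans ?_
    rw [edist_dist, dist_circle_eq_norm_sub]
    refine ENNReal.ofReal_le_ofReal ((norm_sub_le _ _).trans ?_)
    rw [Circle.norm_coe, Circle.norm_coe, one_add_one_eq_two]
  have hd_top : infEDist ζ E ≠ ∞ := ne_top_of_le_ne_top ENNReal.ofReal_ne_top hd_le
  have hd_ne : infEDist ζ E ≠ 0 := by
    rwa [Ne, ← mem_closure_iff_infEDist_zero, hE.closure_eq]
  set d := (infEDist ζ E).toReal with hd
  have hd₀ : 0 < d := ENNReal.toReal_pos hd_ne hd_top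
  have hd₂ : d ≤ 2 := ENNReal.toReal_le_of_le_ofReal (by norm_num) hd_le
  set v := (inverseSquarePotential μ ζ).toReal with hv
  have hdv : 32 < v * d := by
    have := ENNReal.toReal_strict_mono hV hgt
    rwa [ENNReal.toReal_mul, ENNReal.toReal_inv, ENNReal.toReal_ofNat, ← div_eq_mul_inv,
      ← hd, ← hv, div_lt_iff₀ hd₀] at this
  have hv_gt : 16 < v := by nlinarith
  rw [← ENNReal.ofReal_toReal hV, ← hv, ENNReal.ofReal_rpow_of_pos (by linarith)]
  refine rpow_inverseSquarePotential_le_radialArea hp μ hv hv_gt.le ?_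
  filter_upwards [ae_infEDist_le_enorm_sub hμ ζ] with ξ hξ
  rw [← ofReal_norm] at hξ
  refine le_trans ?_ (ENNReal.toReal_le_of_le_ofReal (norm_nonneg _) hξ)
  rw [div_le_iff₀ (by linarith)]
  linarith

lemma lintegral_potential_lt_top_of_isBeurlingCarleson {p : ℝ} (hp₀ : 0 < p) (hp : p < 1)
    (μ : Measure Circle) [IsFiniteMeasure μ] {E : Set Circle} (hE : IsBeurlingCarleson (1 - p) E)
    (hμ : μ Eᶜ = 0) (hA : AreaCondition (1 + p) μ) :
    ∫⁻ ζ : Circle, inverseSquarePotential μ ζ ^ p ∂circleArcLength < ∞ := by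
  rcases E.eq_empty_or_nonempty with rfl | hne
  · have : μ = 0 := by simpa using hμ
    simp [this, inverseSquarePotential, hp₀]
  have h32 : (32 : ℝ≥0∞) ^ p < ∞ := ENNReal.rpow_lt_top_of_nonneg hp₀.le (by simp)
  calc _ ≤ ∫⁻ ζ, (32 ^ p * infEDist ζ E ^ (-p) + ENNReal.ofReal (4 ^ p * 2 ^ (2 + p)) *
        radialArea (1 + p) μ (Real.exp (-1)) ζ) ∂circleArcLength := by
        refine lintegral_mono_ae ?_
        filter_upwards [measure_eq_zero_iff_ae_notMem.1 hE.length_eq_zero] with ζ hζ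
        exact rpow_inverseSquarePotential_le hp₀.le μ hE.isClosed hne hμ hζ
    _ < ∞ := by
        rw [lintegral_add_left (by fun_prop), lintegral_const_mul' _ _ h32.ne,
          lintegral_const_mul' _ _ ENNReal.ofReal_ne_top]
        exact ENNReal.add_lt_top.2
          ⟨ENNReal.mul_lt_top h32 (hE.lintegral_infEDist_rpow_neg_lt_top hp₀.le hp hne),
            ENNReal.mul_lt_top ENNReal.ofReal_lt_top
              ((areaCondition_iff _ _).1 hA _ (Real.exp_pos _) (by simp))⟩

/-! ### Densities of measures on the circle -/

lemma ae_tendsto_closedBall_div_of_isometry {X Y : Type*} [MetricSpace X] [CompleteSpace X]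
    [MeasurableSpace X] [BorelSpace X] [MetricSpace Y] [SecondCountableTopology Y]
    [HasBesicovitchCovering Y] [MeasurableSpace Y] [BorelSpace Y] {f : X → Y} (hf : Isometry f)
    (ρ μ : Measure X) [IsFiniteMeasure ρ] [IsFiniteMeasure μ] :
    ∀ᵐ x ∂μ, Tendsto (fun h ↦ ρ (closedBall x h) / μ (closedBall x h)) (𝓝[>] 0)
      (𝓝 (ρ.rnDeriv μ x)) := by
  have hf' : MeasurableEmbedding f := hf.isClosedEmbedding.measurableEmbedding
  have h := Besicovitch.ae_tendsto_rnDeriv (ρ.map f) (μ.map f)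
  rw [hf'.ae_map_iff] at h
  filter_upwards [h, hf'.rnDeriv_map ρ μ] with x hx hx_eq
  simpa only [hx_eq, hf'.map_apply, hf.preimage_closedBall] using hx

lemma ae_tendsto_closedBall_div (ρ μ : Measure Circle) [IsFiniteMeasure ρ] [IsFiniteMeasure μ] :
    ∀ᵐ ζ ∂μ, Tendsto (fun h ↦ ρ (closedBall ζ h) / μ (closedBall ζ h)) (𝓝[>] 0)
      (𝓝 (ρ.rnDeriv μ ζ)) :=
  ae_tendsto_closedBall_div_of_isometry (X := Circle) (Y := ℂ) (f := fun ζ ↦ ζ)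
    (Isometry.of_dist_eq fun _ _ ↦ rfl) ρ μ

lemma ae_eventually_mul_le_measure_closedBall {μ : Measure Circle} [IsFiniteMeasure μ]
    (hs : μ ⟂ₘ circleArcLength) {K : ℝ} (hK : 0 < K) :
    ∀ᵐ ξ ∂μ, ∀ᶠ h in 𝓝[>] 0, K * h ≤ μ.real (closedBall ξ h) := by
  filter_upwards [ae_tendsto_closedBall_div circleArcLength μ,
    (Measure.rnDeriv_eq_zero _ _).2 hs.symm] with ξ hξ hξ_zero
  rw [hξ_zero] at hξ
  have hsmall := hξ.eventually_lt_const (ENNReal.ofReal_pos.2 (inv_pos.2 hK))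
  filter_upwards [hsmall, Ioo_mem_nhdsGT one_pos] with h hh ⟨_, hh₁⟩
  have hle : ENNReal.ofReal h ≤ ENNReal.ofReal K⁻¹ * μ (closedBall ξ h) :=
    (le_circleArcLength_closedBall ξ hh₁.le).trans <|
      (ENNReal.div_le_iff_le_mul (by simp) (Or.inl (measure_ne_top _ _))).1 hh.le
  rw [← ofReal_measureReal, ← ENNReal.ofReal_mul (by positivity),
    ENNReal.ofReal_le_ofReal_iff (by positivity)] at hle
  rwa [le_inv_mul_iff₀ hK] at hle

/-! ### Decomposing a measure that satisfies the area condition -/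

lemma measure_closedBall_le_inverseSquarePotential (μ : Measure Circle) (ξ : Circle) {h : ℝ}
    (hh : 0 < h) :
    (ENNReal.ofReal (2 * h) ^ 2)⁻¹ * μ (closedBall ξ h) ≤
      inverseSquarePotential μ ((1 - h : ℝ) * ξ) := by
  rw [inverseSquarePotential, ← setLIntegral_const]
  refine le_trans (setLIntegral_mono' measurableSet_closedBall fun η hη ↦ ?_)
    (setLIntegral_le_lintegral _ _)
  rw [mem_closedBall, dist_circle_eq_norm_sub] at hη
  have : ‖(η : ℂ) - (1 - h : ℝ) * ξ‖ ≤ 2 * h :=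
    calc ‖(η : ℂ) - (1 - h : ℝ) * ξ‖ = ‖((η : ℂ) - ξ) + (h : ℂ) * ξ‖ := by
          congr 1
          push_cast
          ring
      _ ≤ h + h := (norm_add_le _ _).trans (add_le_add hη (norm_ofReal_mul_circle hh.le ξ).le)
      _ = 2 * h := (two_mul h).symm
  rw [← ofReal_norm]
  gcongr

lemma norm_singularInner_le_of_le_measure_closedBall (μ : Measure Circle) [IsFiniteMeasure μ]
    {ξ : Circle} {K r : ℝ} (hr₀ : 0 ≤ r) (hr : r < 1)
    (hK : K * (1 - r) ≤ μ.real (closedBall ξ (1 - r))) :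
    ‖singularInner μ (r * ξ)‖ ≤ Real.exp (-(K / 4)) := by
  have hr' : 0 < 1 - r := sub_pos.2 hr
  have hz := norm_ofReal_mul_circle_lt_one hr₀ hr ξ
  have hV := ENNReal.toReal_mono (inverseSquarePotential_lt_top μ hz).ne
    (by simpa only [sub_sub_cancel] using measure_closedBall_le_inverseSquarePotential μ ξ hr')
  rw [ENNReal.toReal_mul, ENNReal.toReal_inv, ENNReal.toReal_pow,
    ENNReal.toReal_ofReal (by positivity)] at hV
  rw [norm_singularInner μ hz, norm_ofReal_mul_circle hr₀]
  gcongr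
  set v := (inverseSquarePotential μ (r * ξ)).toReal
  have hv₀ : 0 ≤ v := ENNReal.toReal_nonneg
  have hv : K / 4 ≤ (1 - r) * v :=
    calc K / 4 = (1 - r) * (((2 * (1 - r)) ^ 2)⁻¹ * (K * (1 - r))) := by field_simp; norm_num
      _ ≤ (1 - r) * v := by gcongr; exact le_trans (by gcongr; exact hK) hV
  nlinarith [mul_nonneg (mul_nonneg hr₀ hr'.le) hv₀]

lemma norm_singularInner_pow_four_le (μ : Measure Circle) [IsFiniteMeasure μ] {ζ ξ : Circle}
    {r : ℝ} (hr₀ : 0 ≤ r) (hr : r < 1) (h : ‖(ζ : ℂ) - ξ‖ ≤ 1 - r) :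
    ‖singularInner μ (r * ζ)‖ ^ 4 ≤ ‖singularInner μ (r * ξ)‖ := by
  have hζ := norm_ofReal_mul_circle_lt_one hr₀ hr ζ
  have hξ := norm_ofReal_mul_circle_lt_one hr₀ hr ξ
  have hdist : ‖(r * ξ : ℂ) - r * ζ‖ ≤ 1 - ‖(r * ξ : ℂ)‖ := by
    rw [← mul_sub, norm_mul, Complex.norm_of_nonneg hr₀, norm_sub_rev, norm_ofReal_mul_circle hr₀]
    exact (mul_le_of_le_one_left (norm_nonneg _) hr.le).trans h
  have hV := ENNReal.toReal_mono
    (ENNReal.mul_ne_top (by simp) (inverseSquarePotential_lt_top μ hζ).ne)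
    (inverseSquarePotential_le_four_mul_of_norm_sub_le μ hdist)
  rw [ENNReal.toReal_mul, ENNReal.toReal_ofNat] at hV
  rw [norm_singularInner μ hζ, norm_singularInner μ hξ, norm_ofReal_mul_circle hr₀,
    norm_ofReal_mul_circle hr₀, ← Real.exp_nat_mul, Real.exp_le_exp]
  have hr_sq : 0 ≤ 1 - r ^ 2 := by nlinarith
  push_cast
  linarith [mul_le_mul_of_nonneg_left hV hr_sq]

/-- The set of boundary points at which `|S_μ| ≤ e⁻⁸` on the last part, of length `δ`, of the
radius. The level `e⁻⁸` is small enough for `|S_μ| < e⁻¹` to persist on the Stolz angles with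
vertex in this set. -/
def smallRadii (μ : Measure Circle) (δ : ℝ) : Set Circle :=
  {ξ | ∀ r ∈ Ico (1 - δ) 1, ‖singularInner μ ((r : ℝ) * ξ)‖ ≤ Real.exp (-8)}

lemma isClosed_smallRadii (μ : Measure Circle) [IsFiniteMeasure μ] {δ : ℝ} (hδ : δ ≤ 1) :
    IsClosed (smallRadii μ δ) := by
  simp only [smallRadii, ofPred_forall]
  refine isClosed_biInter fun r hr ↦ isClosed_le (Continuous.norm ?_) continuous_const
  refine (differentiableOn_singularInner μ).continuousOn.comp_continuous (by fun_prop) fun ξ ↦ ?_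
  rw [mem_ball_zero_iff]
  exact norm_ofReal_mul_circle_lt_one (by linarith [hr.1]) hr.2 ξ

lemma smallRadii_anti (μ : Measure Circle) : Antitone (smallRadii μ) :=
  fun _ _ h _ hξ r hr ↦ hξ r ⟨by linarith [hr.1], hr.2⟩

lemma ae_exists_mem_smallRadii {μ : Measure Circle} [IsFiniteMeasure μ]
    (hs : μ ⟂ₘ circleArcLength) : ∀ᵐ ξ ∂μ, ∃ δ > 0, ξ ∈ smallRadii μ δ := by
  filter_upwards [ae_eventually_mul_le_measure_closedBall hs (K := 32) (by norm_num)] with ξ hξ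
  obtain ⟨ε, hε, hsub⟩ := mem_nhdsGT_iff_exists_Ioo_subset.1 hξ
  rw [mem_Ioi] at hε
  refine ⟨min (ε / 2) 1, by positivity, fun r hr ↦ ?_⟩
  have hr_le : 1 - r ≤ min (ε / 2) 1 := by linarith [hr.1]
  have hr_mem : 1 - r ∈ Ioo 0 ε :=
    ⟨sub_pos.2 hr.2, (hr_le.trans (min_le_left _ _)).trans_lt (by linarith)⟩
  convert norm_singularInner_le_of_le_measure_closedBall μ
    (by linarith [hr_le.trans (min_le_right _ _)]) hr.2 (hsub hr_mem) using 2
  norm_num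

lemma norm_singularInner_lt_of_mem_smallRadii {μ : Measure Circle} [IsFiniteMeasure μ] {δ r : ℝ}
    {ζ ξ : Circle} (hξ : ξ ∈ smallRadii μ δ) (hr₀ : 0 ≤ r) (hr : r ∈ Ico (1 - δ) 1)
    (h : ‖(ζ : ℂ) - ξ‖ ≤ 1 - r) : ‖singularInner μ (r * ζ)‖ < Real.exp (-1) := by
  refine lt_of_pow_lt_pow_left₀ 4 (Real.exp_nonneg _) ?_
  calc ‖singularInner μ (r * ζ)‖ ^ 4 ≤ ‖singularInner μ (r * ξ)‖ :=
        norm_singularInner_pow_four_le μ hr₀ hr.2 h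
    _ ≤ Real.exp (-8) := hξ r hr
    _ < Real.exp (-1) ^ 4 := by
        rw [← Real.exp_nat_mul, Real.exp_lt_exp]
        norm_num

lemma infEDist_smallRadii_rpow_neg_le {p : ℝ} (hp : 0 ≤ p) (μ : Measure Circle)
    [IsFiniteMeasure μ] {δ : ℝ} (hδ : δ ≤ 1 / 2) (hne : (smallRadii μ δ).Nonempty)
    (ζ : Circle) :
    infEDist ζ (smallRadii μ δ) ^ (-p) ≤ ENNReal.ofReal (δ / 2) ^ (-p) +
      ENNReal.ofReal (2 ^ (2 + p)) * radialArea (1 + p) μ (Real.exp (-1)) ζ := by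
  obtain ⟨ξ, hξ, hd⟩ :=
    (isClosed_smallRadii μ (by linarith)).isCompact.exists_infEDist_eq_edist hne ζ
  rw [hd, edist_dist]
  set d := dist ζ ξ
  have hd₀ : 0 ≤ d := dist_nonneg
  rcases le_or_gt (δ / 2) d with h | h
  · exact (ennreal_rpow_neg_antitone hp (ENNReal.ofReal_le_ofReal h)).trans le_self_add
  refine le_trans ?_ le_add_self
  have hlim : Tendsto (fun a ↦ ENNReal.ofReal a ^ (-p)) (𝓝[>] d) (𝓝 (ENNReal.ofReal d ^ (-p))) :=
    ((ENNReal.continuous_rpow_const.comp ENNReal.continuous_ofReal).tendsto d).mono_left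
      nhdsWithin_le_nhds
  refine le_of_tendsto hlim ?_
  filter_upwards [Ioo_mem_nhdsGT h] with a ⟨hda, ha⟩
  have ha₀ : 0 < a := hd₀.trans_lt hda
  rw [ENNReal.ofReal_rpow_of_pos ha₀]
  refine ofReal_rpow_neg_le_setLIntegral_radial hp ha₀ (by linarith) fun r ⟨hr, hr'⟩ ↦ ?_
  refine ⟨⟨by linarith, by linarith⟩, norm_singularInner_lt_of_mem_smallRadii hξ (by linarith)
    ⟨by linarith, by linarith⟩ ?_⟩
  rw [← dist_circle_eq_norm_sub]
  linarith

lemma AreaCondition.isBeurlingCarleson_smallRadii {p : ℝ} (hp : 0 < p) {μ : Measure Circle}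
    [IsFiniteMeasure μ] (hA : AreaCondition (1 + p) μ) {δ : ℝ} (hδ₀ : 0 < δ) (hδ : δ ≤ 1 / 2)
    (hne : (smallRadii μ δ).Nonempty) : IsBeurlingCarleson (1 - p) (smallRadii μ δ) := by
  refine .of_lintegral_infEDist_rpow_neg_lt_top hp (isClosed_smallRadii μ (by linarith)) hne ?_
  refine lt_of_le_of_lt
    (lintegral_mono (infEDist_smallRadii_rpow_neg_le hp.le μ hδ hne)) ?_
  rw [lintegral_add_left measurable_const, lintegral_const, lintegral_const_mul' _ _ (by simp),
    ENNReal.ofReal_rpow_of_pos (by positivity)]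
  exact ENNReal.add_lt_top.2 ⟨ENNReal.mul_lt_top ENNReal.ofReal_lt_top (measure_lt_top _ _),
    ENNReal.mul_lt_top ENNReal.ofReal_lt_top
      ((areaCondition_iff _ _).1 hA _ (Real.exp_pos _) (by simp))⟩

lemma AreaCondition.mono {s : ℝ} {μ ν : Measure Circle} [IsFiniteMeasure μ] [IsFiniteMeasure ν]
    (hA : AreaCondition s μ) (h : ν ≤ μ) : AreaCondition s ν := by
  refine fun c hc₀ hc ↦ lt_of_le_of_lt (lintegral_mono_set ?_) (hA c hc₀ hc)
  rintro z ⟨hz, hzc⟩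
  refine ⟨hz, lt_of_le_of_lt ?_ hzc⟩
  rw [norm_singularInner μ hz, norm_singularInner ν hz]
  have : 0 ≤ 1 - ‖z‖ ^ 2 := by nlinarith [norm_nonneg z]
  gcongr
  · exact (inverseSquarePotential_lt_top μ hz).ne
  · exact inverseSquarePotential_mono h z

lemma AreaCondition.memHardy_deriv_restrict {p : ℝ} (hp₀ : 0 < p) (hp : p < 1)
    {μ : Measure Circle} [IsFiniteMeasure μ] (hA : AreaCondition (1 + p) μ) {δ : ℝ} (hδ₀ : 0 < δ)
    (hδ : δ ≤ 1 / 2) {F : Set Circle} (hF : F ⊆ smallRadii μ δ) :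
    MemHardy p (deriv (singularInner (μ.restrict F))) := by
  refine memHardy_deriv_of_lintegral_potential_lt_top hp₀.le _ ?_
  rcases (smallRadii μ δ).eq_empty_or_nonempty with hempty | hne
  · simp [subset_empty_iff.1 (hF.trans hempty.subset), inverseSquarePotential, hp₀]
  refine lintegral_potential_lt_top_of_isBeurlingCarleson hp₀ hp _
    (hA.isBeurlingCarleson_smallRadii hp₀ hδ₀ hδ hne) ?_ (hA.mono Measure.restrict_le_self)
  rw [Measure.restrict_apply (isClosed_smallRadii μ (by linarith)).measurableSet.compl,
    (disjoint_compl_left_iff_subset.2 hF).inter_eq, measure_empty]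

lemma AreaCondition.upToCountableSums_memHardy_deriv {p : ℝ} (hp₀ : 0 < p) (hp : p < 1)
    {μ : Measure Circle} [IsFiniteMeasure μ] (hs : μ ⟂ₘ circleArcLength)
    (hA : AreaCondition (1 + p) μ) :
    UpToCountableSums (fun ν ↦ MemHardy p (deriv (singularInner ν))) μ := by
  set δ : ℕ → ℝ := fun j ↦ 1 / (j + 2)
  have hδ (j : ℕ) : δ j ≤ 1 / 2 := by
    simp only [δ]
    gcongr
    linarith [j.cast_nonneg (α := ℝ)]
  set E : ℕ → Set Circle := fun j ↦ smallRadii μ (δ j)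
  have hE (j : ℕ) : MeasurableSet (E j) :=
    (isClosed_smallRadii μ ((hδ j).trans (by norm_num))).measurableSet
  have hcover : ∀ᵐ ξ ∂μ, ξ ∈ ⋃ j, E j := by
    filter_upwards [ae_exists_mem_smallRadii hs] with ξ ⟨ε, hε, hξ⟩
    obtain ⟨j, hj⟩ := exists_nat_one_div_lt hε
    refine mem_iUnion.2 ⟨j, smallRadii_anti μ (le_trans ?_ hj.le) hξ⟩
    simp only [δ]
    gcongr
    norm_num
  refine ⟨fun j ↦ μ.restrict (disjointed E j), fun j ↦ ⟨inferInstance, ?_⟩, ?_⟩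
  · exact hA.memHardy_deriv_restrict hp₀ hp (by positivity) (hδ j) (disjointed_subset E j)
  · rw [← Measure.restrict_iUnion (disjoint_disjointed E) fun j ↦ .disjointed hE j,
      iUnion_disjointed, Measure.restrict_eq_self_of_ae_mem hcover]

lemma UpToCountableSums.bind {P : Measure Circle → Prop} {ν : ℕ → Measure Circle}
    (h : ∀ k, UpToCountableSums P (ν k)) : UpToCountableSums P (Measure.sum ν) := by
  choose κ hκ hsum using h
  refine ⟨fun n ↦ κ n.unpair.1 n.unpair.2, fun n ↦ hκ _ _, ?_⟩
  calc Measure.sum ν = Measure.sum fun k ↦ Measure.sum (κ k) := congrArg _ (funext hsum)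
    _ = Measure.sum fun q : ℕ × ℕ ↦ κ q.1 q.2 := Measure.sum_sum κ
    _ = _ := (Measure.sum_comp_equiv Nat.pairEquiv.symm fun q : ℕ × ℕ ↦ κ q.1 q.2).symm

/-! ### Harmonic measure and subharmonicity of `|f| ^ p` -/

/-- The harmonic measure of the unit disk as seen from `a`, i.e. arc length weighted by the
normalised Poisson kernel of `a`. It represents evaluation at `a`. -/
noncomputable def harmonicMeasure (a : ℂ) : Measure Circle :=
  circleArcLength.withDensity fun ζ ↦ ENNReal.ofReal ((2 * π)⁻¹ * poissonKernel 0 a ζ)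

lemma poissonKernel_zero_circle (a : ℂ) (ζ : Circle) :
    poissonKernel 0 a ζ = (1 - ‖a‖ ^ 2) * (‖(ζ : ℂ) - a‖ ^ 2)⁻¹ := by
  simp [poissonKernel_def, div_eq_mul_inv, Circle.norm_coe]

lemma poissonKernel_zero_circle_nonneg {a : ℂ} (ha : ‖a‖ < 1) (ζ : Circle) :
    0 ≤ poissonKernel 0 a ζ := by
  rw [poissonKernel_zero_circle]
  have : 0 ≤ 1 - ‖a‖ ^ 2 := by nlinarith [norm_nonneg a]
  positivity

lemma continuous_poissonKernel_circle {a : ℂ} (ha : ‖a‖ < 1) :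
    Continuous fun ζ : Circle ↦ poissonKernel 0 a ζ := by
  simp only [poissonKernel_zero_circle]
  exact continuous_const.mul <|
    Continuous.inv₀ (by fun_prop) fun ζ ↦ by simpa using circle_sub_ne_zero ζ ha

lemma circleAverage_eq_integral_circleArcLength {E : Type*} [NormedAddCommGroup E]
    [NormedSpace ℝ E] {f : ℂ → E} (hf : Continuous fun ζ : Circle ↦ f ζ) :
    Real.circleAverage f 0 1 = (2 * π)⁻¹ • ∫ ζ : Circle, f ζ ∂circleArcLength := by
  have hper : Function.Periodic (fun θ : ℝ ↦ f (Circle.exp θ)) (2 * π) := fun θ ↦ by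
    simp only [Circle.exp_add_two_pi]
  have hshift := hper.intervalIntegral_add_eq 0 (-π)
  rw [zero_add, show -π + 2 * π = π by ring] at hshift
  rw [Real.circleAverage, circleArcLength,
    integral_map Circle.exp.continuous.aemeasurable hf.aestronglyMeasurable_of_compactSpace,
    ← intervalIntegral.integral_of_le (by linarith [Real.pi_pos]), ← hshift]
  congr 1
  exact intervalIntegral.integral_congr fun θ _ ↦ by simp [circleMap, Circle.coe_exp]

lemma integral_harmonicMeasure {E : Type*} [NormedAddCommGroup E] [NormedSpace ℝ E] {a : ℂ}
    (ha : ‖a‖ < 1) (g : Circle → E) :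
    ∫ ζ, g ζ ∂harmonicMeasure a =
      (2 * π)⁻¹ • ∫ ζ : Circle, poissonKernel 0 a ζ • g ζ ∂circleArcLength := by
  have hm := (continuous_poissonKernel_circle ha).measurable
  rw [harmonicMeasure, integral_withDensity_eq_integral_toReal_smul (by fun_prop)
    (ae_of_all _ fun _ ↦ ENNReal.ofReal_lt_top), ← integral_smul]
  refine integral_congr_ae (ae_of_all _ fun ζ ↦ ?_)
  have := poissonKernel_zero_circle_nonneg ha ζ
  simp only [ENNReal.toReal_ofReal (show 0 ≤ (2 * π)⁻¹ * poissonKernel 0 a ζ by positivity),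
    mul_smul]

lemma continuous_circle_of_diffContOnCl {E : Type*} [NormedAddCommGroup E] [NormedSpace ℂ E]
    {f : ℂ → E} (hf : DiffContOnCl ℂ f (ball 0 1)) : Continuous fun ζ : Circle ↦ f ζ :=
  hf.continuousOn.comp_continuous (by fun_prop) fun ζ ↦ by simp [closure_ball, Circle.norm_coe]

lemma integral_harmonicMeasure_of_diffContOnCl {E : Type*} [NormedAddCommGroup E]
    [NormedSpace ℂ E] [CompleteSpace E] {f : ℂ → E} (hf : DiffContOnCl ℂ f (ball 0 1))
    {a : ℂ} (ha : ‖a‖ < 1) : ∫ ζ : Circle, f ζ ∂harmonicMeasure a = f a := by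
  have hPf : Continuous fun ζ : Circle ↦ (poissonKernel 0 a • f) (ζ : ℂ) :=
    (continuous_poissonKernel_circle ha).smul (continuous_circle_of_diffContOnCl hf)
  rw [integral_harmonicMeasure ha,
    ← hf.circleAverage_poissonKernel_smul (w := a) (by simpa using ha),
    circleAverage_eq_integral_circleArcLength hPf]
  rfl

lemma isProbabilityMeasure_harmonicMeasure {a : ℂ} (ha : ‖a‖ < 1) :
    IsProbabilityMeasure (harmonicMeasure a) := by
  have h := integral_harmonicMeasure_of_diffContOnCl (diffContOnCl_const (c := (1 : ℂ))) ha
  rw [integral_const, Complex.real_smul, mul_one, Complex.ofReal_eq_one] at h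
  exact ⟨(ENNReal.toReal_eq_one_iff _).1 h⟩

lemma exists_add_conj_of_mem_span_fourier {T : ℝ} [Fact (0 < T)] {g : C(AddCircle T, ℂ)}
    (hg : g ∈ Submodule.span ℂ (range (fourier (T := T)))) :
    ∃ q₁ q₂ : ℂ → ℂ, Differentiable ℂ q₁ ∧ Differentiable ℂ q₂ ∧
      ∀ x : AddCircle T, g x = q₁ x.toCircle + (starRingEnd ℂ) (q₂ x.toCircle) := by
  induction hg using Submodule.span_induction with
  | mem g hg =>
    obtain ⟨n, rfl⟩ := hg
    obtain ⟨k, rfl | rfl⟩ := n.eq_nat_or_neg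
    · exact ⟨fun z ↦ z ^ k, 0, by fun_prop, by fun_prop, fun x ↦ by simp [AddCircle.toCircle_nsmul]⟩
    · exact ⟨0, fun z ↦ z ^ k, by fun_prop, by fun_prop, fun x ↦ by
        rw [fourier_neg]
        simp [AddCircle.toCircle_nsmul]⟩
  | zero => exact ⟨0, 0, by fun_prop, by fun_prop, fun x ↦ by simp⟩
  | add g g' _ _ hg hg' =>
    obtain ⟨a, b, ha, hb, hg⟩ := hg
    obtain ⟨c, d, hc, hd, hg'⟩ := hg'
    refine ⟨a + c, b + d, ha.add hc, hb.add hd, fun x ↦ ?_⟩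
    simp only [ContinuousMap.add_apply, Pi.add_apply, map_add, hg, hg']
    ring
  | smul c g _ hg =>
    obtain ⟨a, b, ha, hb, hg⟩ := hg
    refine ⟨c • a, (starRingEnd ℂ) c • b, ha.const_smul _, hb.const_smul _, fun x ↦ ?_⟩
    simp only [ContinuousMap.smul_apply, Pi.smul_apply, hg, smul_eq_mul, map_mul,
      Complex.conj_conj]
    ring

lemma exists_differentiable_abs_re_sub_lt (φ : C(Circle, ℝ)) {ε : ℝ} (hε : 0 < ε) :
    ∃ q : ℂ → ℂ, Differentiable ℂ q ∧ ∀ ζ : Circle, |(q ζ).re - φ ζ| < ε := by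
  have : Fact (0 < 2 * π) := ⟨Real.two_pi_pos⟩
  let f : C(AddCircle (2 * π), ℂ) := ⟨fun x ↦ φ x.toCircle, by fun_prop⟩
  have hf : f ∈ (Submodule.span ℂ (range (fourier (T := 2 * π)))).topologicalClosure := by
    simp only [span_fourier_closure_eq_top, Submodule.mem_top]
  obtain ⟨g, hg, hfg⟩ := Metric.mem_closure_iff.1 hf ε hε
  obtain ⟨q₁, q₂, hq₁, hq₂, hgq⟩ := exists_add_conj_of_mem_span_fourier hg
  refine ⟨q₁ + q₂, hq₁.add hq₂, fun ζ ↦ ?_⟩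
  obtain ⟨x, rfl⟩ := (AddCircle.homeomorphCircle Real.two_pi_pos.ne').surjective ζ
  rw [AddCircle.homeomorphCircle_apply]
  calc |((q₁ + q₂) x.toCircle).re - φ x.toCircle| = |(g x - f x).re| := by simp [f, hgq]
    _ ≤ ‖g x - f x‖ := Complex.abs_re_le_norm _
    _ = dist (f x) (g x) := by rw [dist_comm, dist_eq_norm]
    _ < ε := (ContinuousMap.dist_apply_le_dist x).trans_lt hfg

lemma exists_differentiable_le_re_le_add (φ : C(Circle, ℝ)) {ε : ℝ} (hε : 0 < ε) :
    ∃ q : ℂ → ℂ, Differentiable ℂ q ∧ ∀ ζ : Circle, φ ζ ≤ (q ζ).re ∧ (q ζ).re ≤ φ ζ + ε := by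
  obtain ⟨q, hq, hqφ⟩ := exists_differentiable_abs_re_sub_lt (φ + .const _ (ε / 2)) (half_pos hε)
  refine ⟨q, hq, fun ζ ↦ ?_⟩
  have := abs_lt.1 (hqφ ζ)
  simp only [ContinuousMap.add_apply, ContinuousMap.const_apply] at this
  constructor <;> linarith

lemma norm_le_exp_re_of_forall_circle {f q : ℂ → ℂ} (hf : DiffContOnCl ℂ f (ball 0 1))
    (hq : Differentiable ℂ q) (h : ∀ ζ : Circle, ‖f ζ‖ ≤ Real.exp (q ζ).re) {a : ℂ}
    (ha : ‖a‖ ≤ 1) : ‖f a‖ ≤ Real.exp (q a).re := by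
  have hmul (z : ℂ) : ‖f z * Complex.exp (-q z)‖ ≤ 1 ↔ ‖f z‖ ≤ Real.exp (q z).re := by
    rw [norm_mul, Complex.norm_exp, Complex.neg_re, Real.exp_neg, ← div_eq_mul_inv,
      div_le_one (Real.exp_pos _)]
  rw [← hmul]
  refine Complex.norm_le_of_forall_mem_frontier_norm_le (isBounded_ball (x := 0) (r := 1))
    (hf.smul hq.neg.cexp.diffContOnCl) (fun z hz ↦ ?_) (by simpa [closure_ball] using ha)
  rw [frontier_ball _ one_ne_zero] at hz
  exact (hmul z).2 (h ⟨z, hz⟩)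

/-- The approximation of `log |f| ^ p` by real parts of entire functions replaces the theory of
subharmonic functions. -/
lemma rpow_norm_le_exp_mul_integral_add {p : ℝ} (hp : 0 < p) {f : ℂ → ℂ}
    (hf : DiffContOnCl ℂ f (ball 0 1)) {a : ℂ} (ha : ‖a‖ ≤ 1) (ω : Measure Circle)
    [IsProbabilityMeasure ω] (hω : ∀ q : ℂ → ℂ, Differentiable ℂ q → ∫ ζ : Circle, q ζ ∂ω = q a)
    {ε : ℝ} (hε : 0 < ε) :
    ‖f a‖ ^ p ≤ Real.exp ε * (∫ ζ : Circle, ‖f ζ‖ ^ p ∂ω + ε) := by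
  have hfp : Continuous fun ζ : Circle ↦ ‖f ζ‖ ^ p :=
    (continuous_circle_of_diffContOnCl hf).norm.rpow_const fun _ ↦ Or.inr hp.le
  have hint {g : Circle → ℝ} (hg : Continuous g) : Integrable g ω :=
    hg.integrable_of_hasCompactSupport (.of_compactSpace _)
  obtain ⟨q, hq, hqφ⟩ := exists_differentiable_le_re_le_add
    ⟨fun ζ : Circle ↦ Real.log (‖f ζ‖ ^ p + ε),
      Continuous.log (by fun_prop) fun ζ ↦ by positivity⟩ hε
  simp only [ContinuousMap.coe_mk] at hqφ
  have hpos (ζ : Circle) : 0 < ‖f ζ‖ ^ p + ε := by positivity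
  have hf_le : ‖f a‖ ≤ Real.exp (q a / p).re := by
    refine norm_le_exp_re_of_forall_circle hf (hq.div_const _) (fun ζ ↦ ?_) ha
    rw [Complex.div_ofReal_re, div_eq_mul_inv, Real.exp_mul,
      Real.le_rpow_inv_iff_of_pos (norm_nonneg _) (Real.exp_nonneg _) hp]
    exact (le_add_of_nonneg_right hε.le).trans ((Real.log_le_iff_le_exp (hpos ζ)).1 (hqφ ζ).1)
  have hq_cont : Continuous fun ζ : Circle ↦ Real.exp (q ζ).re :=
    Real.continuous_exp.comp (Complex.continuous_re.comp (hq.continuous.comp (by fun_prop)))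
  calc ‖f a‖ ^ p ≤ ‖Complex.exp (q a)‖ := by
        rwa [Complex.div_ofReal_re, div_eq_mul_inv, Real.exp_mul,
          Real.le_rpow_inv_iff_of_pos (norm_nonneg _) (Real.exp_nonneg _) hp,
          ← Complex.norm_exp] at hf_le
    _ ≤ ∫ ζ : Circle, ‖Complex.exp (q ζ)‖ ∂ω := by
        rw [← hω _ hq.cexp]
        exact norm_integral_le_integral_norm _
    _ ≤ ∫ ζ : Circle, Real.exp ε * (‖f ζ‖ ^ p + ε) ∂ω := by
        simp only [Complex.norm_exp]
        refine integral_mono (hint hq_cont) (hint (by fun_prop)) fun ζ ↦ ?_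
        rw [← Real.exp_log (hpos ζ), ← Real.exp_add, Real.exp_le_exp]
        linarith [(hqφ ζ).2]
    _ = _ := by
        rw [integral_const_mul, integral_add (hint hfp) (hint continuous_const)]
        simp

lemma rpow_norm_le_integral_harmonicMeasure {p : ℝ} (hp : 0 < p) {f : ℂ → ℂ}
    (hf : DiffContOnCl ℂ f (ball 0 1)) {a : ℂ} (ha : ‖a‖ < 1) :
    ‖f a‖ ^ p ≤ ∫ ζ : Circle, ‖f ζ‖ ^ p ∂harmonicMeasure a := by
  have := isProbabilityMeasure_harmonicMeasure ha
  have hlim : Tendsto (fun ε ↦ Real.exp ε * (∫ ζ : Circle, ‖f ζ‖ ^ p ∂harmonicMeasure a + ε))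
      (𝓝[>] 0) (𝓝 (Real.exp 0 * (∫ ζ : Circle, ‖f ζ‖ ^ p ∂harmonicMeasure a + 0))) :=
    (Continuous.tendsto (by fun_prop) 0).mono_left nhdsWithin_le_nhds
  rw [Real.exp_zero, one_mul, add_zero] at hlim
  refine ge_of_tendsto hlim (eventually_mem_nhdsWithin.mono fun ε hε ↦ ?_)
  exact rpow_norm_le_exp_mul_integral_add hp hf ha.le _
    (fun q hq ↦ integral_harmonicMeasure_of_diffContOnCl hq.diffContOnCl ha) hε

/-! ### Harmonic majorants of `|f| ^ p` for `f` in the Hardy space -/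

lemma exists_ultrafilter_tendsto_finiteMeasure {X : Type*} [MeasurableSpace X] [TopologicalSpace X]
    [T2Space X] [BorelSpace X] [CompactSpace X] {M : ℕ → FiniteMeasure X} {C : NNReal}
    (hM : ∀ n, (M n).mass ≤ C) :
    ∃ (U : Ultrafilter ℕ) (m : FiniteMeasure X), (U : Filter ℕ) ≤ atTop ∧ Tendsto M U (𝓝 m) := by
  obtain ⟨m, -, hm⟩ :=
    (isCompact_setOfPred_finiteMeasure_le_of_compactSpace X C).ultrafilter_le_nhds
    ((hyperfilter ℕ).map M) (le_principal_iff.2 (Filter.mem_map.2 (univ_mem' hM)))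
  exact ⟨hyperfilter ℕ, m, Nat.cofinite_eq_atTop ▸ hyperfilter_le_cofinite, hm⟩

/-- The measure `|f(rζ)| ^ p |dζ|` on the circle. For `f` in the Hardy space `H ^ p` these have
bounded mass, and their weak limits as `r → 1` give the boundary values of a harmonic majorant. -/
noncomputable def radialMeasure (p : ℝ) (f : ℂ → ℂ) (r : ℝ) : Measure Circle :=
  circleArcLength.withDensity fun ζ ↦ ‖f (r * ζ)‖ₑ ^ p

lemma radialMeasure_univ (p : ℝ) (f : ℂ → ℂ) (r : ℝ) :
    radialMeasure p f r univ = ∫⁻ ζ : Circle, ‖f (r * ζ)‖ₑ ^ p ∂circleArcLength := by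
  rw [radialMeasure, withDensity_apply _ MeasurableSet.univ, setLIntegral_univ]

section Dilation

variable {f : ℂ → ℂ} (hf : DifferentiableOn ℂ f (ball 0 1)) {r : ℝ} (hr₀ : 0 ≤ r) (hr : r < 1)
include hf hr₀ hr

lemma diffContOnCl_dilation : DiffContOnCl ℂ (fun z ↦ f (r * z)) (ball 0 1) := by
  refine DifferentiableOn.diffContOnCl (hf.comp (by fun_prop) fun z hz ↦ ?_)
  rw [closure_ball _ one_ne_zero, mem_closedBall_zero_iff] at hz
  rw [mem_ball_zero_iff, norm_mul, Complex.norm_real, Real.norm_of_nonneg hr₀]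
  nlinarith

lemma continuous_radial_circle : Continuous fun ζ : Circle ↦ f (r * ζ) :=
  continuous_circle_of_diffContOnCl (diffContOnCl_dilation hf hr₀ hr)

lemma rpow_norm_dilation_le_integral_radialMeasure {p : ℝ} (hp : 0 < p) {a : ℂ} (ha : ‖a‖ < 1) :
    ‖f (r * a)‖ ^ p ≤ ∫ ζ : Circle, poissonKernel 0 a ζ ∂radialMeasure p f r := by
  have hm := (continuous_radial_circle hf hr₀ hr).measurable
  have hnonneg (ζ : Circle) := poissonKernel_zero_circle_nonneg ha ζ
  calc ‖f (r * a)‖ ^ p ≤ ∫ ζ : Circle, ‖f (r * ζ)‖ ^ p ∂harmonicMeasure a :=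
        rpow_norm_le_integral_harmonicMeasure hp (diffContOnCl_dilation hf hr₀ hr) ha
    _ = (2 * π)⁻¹ * ∫ ζ : Circle, poissonKernel 0 a ζ ∂radialMeasure p f r := by
        rw [integral_harmonicMeasure ha, radialMeasure,
          integral_withDensity_eq_integral_toReal_smul (hm.enorm.pow_const p)
            (ae_of_all _ fun ζ ↦ ENNReal.rpow_lt_top_of_nonneg hp.le enorm_ne_top), smul_eq_mul]
        congr 2 with ζ
        rw [← ENNReal.toReal_rpow, toReal_enorm, smul_eq_mul, smul_eq_mul, mul_comm]
    _ ≤ _ := by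
        refine mul_le_of_le_one_left (integral_nonneg hnonneg) (inv_le_one_of_one_le₀ ?_)
        linarith [Real.pi_gt_three]

end Dilation

/-- The Poisson integral `∫ (1 - |z|²) / |ξ - z|² dμ(ξ)` of a measure on the circle, for `|z| < 1`.
It is both the exponent in `|S_μ(z)| = exp (-P_μ(z))` and the form in which harmonic majorants
occur. -/
noncomputable def poissonIntegral (μ : Measure Circle) (z : ℂ) : ℝ≥0∞ :=
  ENNReal.ofReal (1 - ‖z‖ ^ 2) * inverseSquarePotential μ z

lemma ofReal_integral_poissonKernel_circle (m : Measure Circle) [IsFiniteMeasure m] {a : ℂ}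
    (ha : ‖a‖ < 1) :
    ENNReal.ofReal (∫ ζ : Circle, poissonKernel 0 a ζ ∂m) = poissonIntegral m a := by
  simp only [poissonKernel_zero_circle]
  rw [integral_const_mul, ENNReal.ofReal_mul (by nlinarith [norm_nonneg a]), poissonIntegral,
    inverseSquarePotential_eq_ofReal_integral (inverseSquarePotential_lt_top m ha)]

lemma MemHardy.exists_measure_rpow_norm_le_poissonIntegral {p : ℝ} (hp : 0 < p) {f : ℂ → ℂ}
    (hf : MemHardy p f) :
    ∃ m : Measure Circle, IsFiniteMeasure m ∧ ∀ a : ℂ, ‖a‖ < 1 →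
      ENNReal.ofReal (‖f a‖ ^ p) ≤ poissonIntegral m a := by
  obtain ⟨hd, hK⟩ := hf
  obtain ⟨R, -, hR, hR_lim⟩ := exists_seq_strictMono_tendsto' (zero_lt_one' ℝ)
  set K := ⨆ r : Ico (0 : ℝ) 1, ∫⁻ ζ : Circle, ‖f ((r : ℝ) * (ζ : ℂ))‖ₑ ^ p ∂circleArcLength
  have hmass (n : ℕ) : radialMeasure p f (R n) univ ≤ K := by
    rw [radialMeasure_univ]
    exact le_iSup (fun r : Ico (0 : ℝ) 1 ↦
      ∫⁻ ζ : Circle, ‖f ((r : ℝ) * (ζ : ℂ))‖ₑ ^ p ∂circleArcLength) ⟨R n, (hR n).1.le, (hR n).2⟩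
  let M : ℕ → FiniteMeasure Circle := fun n ↦ ⟨radialMeasure p f (R n), ⟨(hmass n).trans_lt hK⟩⟩
  obtain ⟨U, m, hU, hm⟩ := exists_ultrafilter_tendsto_finiteMeasure (M := M) (C := K.toNNReal)
    fun n ↦ ENNReal.toNNReal_mono hK.ne (hmass n)
  refine ⟨m, inferInstance, fun a ha ↦ ?_⟩
  have hlim := FiniteMeasure.tendsto_iff_forall_integral_tendsto.1 hm
    (.mkOfCompact ⟨_, continuous_poissonKernel_circle ha⟩)
  have hlim_f : Tendsto (fun n ↦ ‖f (R n * a)‖ ^ p) U (𝓝 (‖f a‖ ^ p)) := by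
    have hcont : ContinuousAt f a :=
      hd.continuousOn.continuousAt (isOpen_ball.mem_nhds (by simpa using ha))
    have hRa : Tendsto (fun n ↦ (R n : ℂ) * a) atTop (𝓝 a) := by
      simpa using ((Complex.continuous_ofReal.tendsto 1).comp hR_lim).mul_const a
    exact (((hcont.tendsto.comp hRa).norm).rpow_const (Or.inr hp.le)).mono_left hU
  rw [← ofReal_integral_poissonKernel_circle m ha]
  gcongr
  exact le_of_tendsto_of_tendsto' hlim_f hlim fun n ↦
    rpow_norm_dilation_le_integral_radialMeasure hd (hR n).1.le (hR n).2 hp ha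

/-! ### Radial behaviour of Poisson integrals -/

section PoissonIntegral

variable {m : Measure Circle} {ζ : Circle}

lemma measure_lt_inv_norm_circle_sub_sq_le {B : ℝ≥0∞} {r : ℝ} (hr₀ : 0 ≤ r) (hr : r < 1)
    (hB : ∀ h : ℝ, 0 < h → m (closedBall ζ h) ≤ B * ENNReal.ofReal h) {t : ℝ} (ht : 0 < t) :
    m {ξ : Circle | t < (‖(ξ : ℂ) - r * ζ‖ ^ 2)⁻¹} ≤
      (Ioo 0 (((1 - r) ^ 2)⁻¹)).indicator
        (fun t ↦ 2 * B * ENNReal.ofReal ((t - 0) ^ (-(1 / 2) : ℝ))) t := by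
  have hr' : 0 < 1 - r := sub_pos.2 hr
  have hdist (ξ : Circle) : 1 - r ≤ ‖(ξ : ℂ) - r * ζ‖ := by
    simpa only [norm_ofReal_mul_circle hr₀] using one_sub_norm_le_norm_circle_sub ξ (r * ζ)
  by_cases htr : t < ((1 - r) ^ 2)⁻¹
  · rw [indicator_of_mem (mem_Ioo.2 ⟨ht, htr⟩), sub_zero]
    calc m {ξ : Circle | t < (‖(ξ : ℂ) - r * ζ‖ ^ 2)⁻¹}
        ≤ m (closedBall ζ (2 * t ^ (-(1 / 2) : ℝ))) := by
          refine measure_mono fun ξ (hξ : t < _) ↦ ?_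
          have hpos : 0 < ‖(ξ : ℂ) - r * ζ‖ := hr'.trans_le (hdist ξ)
          rw [lt_inv_comm₀ ht (by positivity), ← Real.lt_sqrt hpos.le, Real.sqrt_inv,
            Real.sqrt_eq_rpow, ← Real.rpow_neg ht.le] at hξ
          rw [mem_closedBall, dist_circle_eq_norm_sub]
          linarith [norm_circle_sub_le_two_mul ξ ζ hr₀ hr.le]
      _ ≤ B * ENNReal.ofReal (2 * t ^ (-(1 / 2) : ℝ)) := hB _ (by positivity)
      _ = _ := by rw [ENNReal.ofReal_mul (by norm_num), ENNReal.ofReal_ofNat]; ring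
  · rw [indicator_of_notMem fun h ↦ htr h.2, nonpos_iff_eq_zero]
    convert measure_empty (μ := m)
    refine eq_empty_of_forall_notMem fun ξ (hξ : t < _) ↦ htr (hξ.trans_le ?_)
    gcongr
    exact hdist ξ

lemma poissonIntegral_radial_le_of_forall_closedBall {B : ℝ≥0∞}
    (hB : ∀ h : ℝ, 0 < h → m (closedBall ζ h) ≤ B * ENNReal.ofReal h) {r : ℝ} (hr₀ : 0 ≤ r)
    (hr : r < 1) :
    poissonIntegral m (r * ζ) ≤ 8 * B := by
  have hr' : 0 < 1 - r := sub_pos.2 hr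
  have hz := norm_ofReal_mul_circle_lt_one hr₀ hr ζ
  have hV : inverseSquarePotential m (r * ζ) ≤ 2 * B * ENNReal.ofReal (2 / (1 - r)) :=
    calc inverseSquarePotential m (r * ζ)
        = ∫⁻ ξ : Circle, ENNReal.ofReal ((‖(ξ : ℂ) - r * ζ‖ ^ 2)⁻¹) ∂m :=
          inverseSquarePotential_eq_lintegral_ofReal
            (ae_of_all _ fun ξ ↦ sub_ne_zero.1 (circle_sub_ne_zero ξ hz))
      _ = ∫⁻ t in Ioi 0, m {ξ : Circle | t < (‖(ξ : ℂ) - r * ζ‖ ^ 2)⁻¹} :=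
          lintegral_eq_lintegral_meas_lt m (ae_of_all _ fun ξ ↦ by positivity) (by fun_prop)
      _ ≤ ∫⁻ t, (Ioo 0 (((1 - r) ^ 2)⁻¹)).indicator
            (fun t ↦ 2 * B * ENNReal.ofReal ((t - 0) ^ (-(1 / 2) : ℝ))) t :=
          (setLIntegral_mono' measurableSet_Ioi fun t ht ↦
            measure_lt_inv_norm_circle_sub_sq_le hr₀ hr hB ht).trans
            (setLIntegral_le_lintegral _ _)
      _ = 2 * B * ENNReal.ofReal ((((1 - r) ^ 2)⁻¹ - 0) ^ (1 - 1 / 2 : ℝ) / (1 - 1 / 2)) := by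
          rw [lintegral_indicator measurableSet_Ioo, lintegral_const_mul _ (by fun_prop),
            setLIntegral_Ioo_sub_left_rpow_neg (by positivity) (by norm_num)]
      _ = _ := by
          rw [sub_zero, show (1 - 1 / 2 : ℝ) = 1 / 2 by norm_num, ← Real.sqrt_eq_rpow,
            Real.sqrt_inv, Real.sqrt_sq hr'.le]
          congr 2
          field_simp
  rw [poissonIntegral, norm_ofReal_mul_circle hr₀]
  calc _ ≤ ENNReal.ofReal (2 * (1 - r)) * (2 * B * ENNReal.ofReal (2 / (1 - r))) := by
        gcongr
        nlinarith
    _ = ENNReal.ofReal (2 * (1 - r) * (2 / (1 - r))) * (2 * B) := by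
        rw [ENNReal.ofReal_mul (p := 2 * (1 - r)) (by positivity)]
        ring
    _ = 8 * B := by
        rw [show 2 * (1 - r) * (2 / (1 - r)) = 4 by field_simp; norm_num, ENNReal.ofReal_ofNat,
          ← mul_assoc]
        norm_num

end PoissonIntegral

section RadialLimits

variable {μ : Measure Circle} {ζ : Circle}

lemma tendsto_ofReal_one_sub_sq :
    Tendsto (fun r : ℝ ↦ ENNReal.ofReal (1 - r ^ 2)) (𝓝[<] 1) (𝓝 0) := by
  have h : Continuous fun r : ℝ ↦ ENNReal.ofReal (1 - r ^ 2) :=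
    ENNReal.continuous_ofReal.comp (by fun_prop)
  simpa using (h.tendsto 1).mono_left nhdsWithin_le_nhds

lemma eventually_mem_Ico_zero_one : ∀ᶠ r : ℝ in 𝓝[<] 1, r ∈ Ico (0 : ℝ) 1 :=
  Ico_mem_nhdsLT zero_lt_one

lemma tendsto_poissonIntegral_radial_of_potential_lt_top (hV : inverseSquarePotential μ ζ < ∞) :
    Tendsto (fun r : ℝ ↦ poissonIntegral μ (r * ζ)) (𝓝[<] 1) (𝓝 0) := by
  have h := ENNReal.Tendsto.mul_const (b := 4 * inverseSquarePotential μ ζ)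
    tendsto_ofReal_one_sub_sq (Or.inr (ENNReal.mul_ne_top (by simp) hV.ne))
  rw [zero_mul] at h
  refine tendsto_of_tendsto_of_tendsto_of_le_of_le' tendsto_const_nhds h
    (Eventually.of_forall fun _ ↦ zero_le) ?_
  filter_upwards [eventually_mem_Ico_zero_one] with r hr
  rw [poissonIntegral, norm_ofReal_mul_circle hr.1]
  gcongr
  exact inverseSquarePotential_radial_le μ ζ hr.1 hr.2.le

lemma poissonIntegral_restrict_add_compl (μ : Measure Circle) {s : Set Circle}
    (hs : MeasurableSet s) (z : ℂ) :
    poissonIntegral (μ.restrict s) z + poissonIntegral (μ.restrict sᶜ) z = poissonIntegral μ z := by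
  simp only [poissonIntegral, inverseSquarePotential]
  rw [← mul_add, lintegral_add_compl _ hs]

lemma eventually_measure_closedBall_le {L L' : ℝ≥0∞} (hL : L < L')
    (h : Tendsto (fun h ↦ μ (closedBall ζ h) / circleArcLength (closedBall ζ h)) (𝓝[>] 0) (𝓝 L)) :
    ∀ᶠ h in 𝓝[>] (0 : ℝ), μ (closedBall ζ h) ≤ L' * ENNReal.ofReal π * ENNReal.ofReal h := by
  filter_upwards [h.eventually_lt_const hL, Ioc_mem_nhdsGT one_pos] with t ht ht01
  have hne : circleArcLength (closedBall ζ t) ≠ 0 :=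
    ((ENNReal.ofReal_pos.2 ht01.1).trans_le (le_circleArcLength_closedBall ζ ht01.2)).ne'
  calc μ (closedBall ζ t) ≤ L' * circleArcLength (closedBall ζ t) :=
        ((ENNReal.div_lt_iff (Or.inl hne) (Or.inl (measure_ne_top _ _))).1 ht).le
    _ ≤ L' * ENNReal.ofReal (π * t) := by
        gcongr
        exact circleArcLength_closedBall_le ζ t
    _ = _ := by rw [ENNReal.ofReal_mul Real.pi_nonneg, mul_assoc]

variable [IsFiniteMeasure μ]

lemma eventually_poissonIntegral_radial_le {B ε : ℝ≥0∞} (hε : ε ≠ 0)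
    (hB : ∀ᶠ h in 𝓝[>] (0 : ℝ), μ (closedBall ζ h) ≤ B * ENNReal.ofReal h) :
    ∀ᶠ r : ℝ in 𝓝[<] 1, poissonIntegral μ (r * ζ) ≤ 8 * B + ε := by
  obtain ⟨δ, hδ : 0 < δ, hB⟩ := mem_nhdsGT_iff_exists_Ioc_subset.1 hB
  have hnear (h : ℝ) (hh : 0 < h) :
      μ.restrict (closedBall ζ δ) (closedBall ζ h) ≤ B * ENNReal.ofReal h := by
    rcases le_total h δ with hle | hle
    · exact (Measure.restrict_apply_le _ _).trans (hB ⟨hh, hle⟩)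
    · calc μ.restrict (closedBall ζ δ) (closedBall ζ h) ≤ μ (closedBall ζ δ) := by
            rw [Measure.restrict_apply measurableSet_closedBall]
            exact measure_mono inter_subset_right
        _ ≤ B * ENNReal.ofReal δ := hB ⟨hδ, le_rfl⟩
        _ ≤ B * ENNReal.ofReal h := by gcongr
  have hfar : inverseSquarePotential (μ.restrict (closedBall ζ δ)ᶜ) ζ < ∞ := by
    refine inverseSquarePotential_lt_top_of_notMem (E := (ball ζ δ)ᶜ) isOpen_ball.isClosed_compl ?_
      (by simpa using hδ)
    rw [compl_compl, Measure.restrict_apply isOpen_ball.measurableSet]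
    exact measure_mono_null (fun x hx ↦ hx.2 (ball_subset_closedBall hx.1)) measure_empty
  filter_upwards [eventually_mem_Ico_zero_one,
    (tendsto_poissonIntegral_radial_of_potential_lt_top hfar).eventually_le_const hε.bot_lt]
    with r hr hr_far
  rw [← poissonIntegral_restrict_add_compl μ (measurableSet_closedBall (x := ζ) (ε := δ))]
  exact add_le_add (poissonIntegral_radial_le_of_forall_closedBall hnear hr.1 hr.2) hr_far

lemma ae_exists_eventually_poissonIntegral_radial_le (μ : Measure Circle) [IsFiniteMeasure μ] :
    ∀ᵐ ζ : Circle ∂circleArcLength, ∃ B < ∞, ∀ᶠ r : ℝ in 𝓝[<] 1, poissonIntegral μ (r * ζ) ≤ B := by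
  filter_upwards [ae_tendsto_closedBall_div μ circleArcLength,
    Measure.rnDeriv_lt_top μ circleArcLength] with ζ hζ hL
  refine ⟨_, ?_, eventually_poissonIntegral_radial_le one_ne_zero
    (eventually_measure_closedBall_le (ENNReal.lt_add_right hL.ne one_ne_zero) hζ)⟩
  finiteness

lemma ae_tendsto_poissonIntegral_radial_zero (hs : μ ⟂ₘ circleArcLength) :
    ∀ᵐ ζ : Circle ∂circleArcLength,
      Tendsto (fun r : ℝ ↦ poissonIntegral μ (r * ζ)) (𝓝[<] 1) (𝓝 0) := by
  filter_upwards [ae_tendsto_closedBall_div μ circleArcLength,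
    (Measure.rnDeriv_eq_zero _ _).2 hs] with ζ hζ hL
  rw [hL] at hζ
  refine ENNReal.tendsto_nhds_zero.2 fun ε hε ↦ ?_
  obtain ⟨η, hη, hηε⟩ := ENNReal.exists_nnreal_pos_mul_lt (a := 8 * ENNReal.ofReal π + 1)
    (by finiteness) hε.ne'
  have hη' : (0 : ℝ≥0∞) < η := by exact_mod_cast hη
  filter_upwards [eventually_poissonIntegral_radial_le hη'.ne'
    (eventually_measure_closedBall_le hη' hζ)] with r hr
  calc poissonIntegral μ (r * ζ) ≤ 8 * (η * ENNReal.ofReal π) + η := hr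
    _ = η * (8 * ENNReal.ofReal π + 1) := by ring
    _ ≤ ε := hηε.le

lemma norm_singularInner_eq_exp_neg_poissonIntegral {z : ℂ} (hz : ‖z‖ < 1) :
    ‖singularInner μ z‖ = Real.exp (-(poissonIntegral μ z).toReal) := by
  rw [norm_singularInner μ hz, poissonIntegral, ENNReal.toReal_mul,
    ENNReal.toReal_ofReal (by nlinarith [norm_nonneg z])]

lemma tendsto_norm_singularInner_radial
    (h : Tendsto (fun r : ℝ ↦ poissonIntegral μ (r * ζ)) (𝓝[<] 1) (𝓝 0)) :
    Tendsto (fun r : ℝ ↦ ‖singularInner μ (r * ζ)‖) (𝓝[<] 1) (𝓝 1) := by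
  have h_exp := ((ENNReal.tendsto_toReal ENNReal.zero_ne_top).comp h).neg.rexp
  rw [ENNReal.toReal_zero, neg_zero, Real.exp_zero] at h_exp
  refine h_exp.congr' ?_
  filter_upwards [eventually_mem_Ico_zero_one] with r hr
  exact (norm_singularInner_eq_exp_neg_poissonIntegral
    (norm_ofReal_mul_circle_lt_one hr.1 hr.2 ζ)).symm

end RadialLimits

/-! ### Radial limits of `S_μ'` -/

section BoundedDerivative

variable {μ : Measure Circle} {ζ : Circle}

lemma inverseSquarePotential_le_of_eventually_radial_le {C : ℝ≥0∞}
    (h : ∀ᶠ r : ℝ in 𝓝[<] 1, inverseSquarePotential μ (r * ζ) ≤ C) :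
    inverseSquarePotential μ ζ ≤ C := by
  have hlim (ξ : Circle) : Tendsto (fun r : ℝ ↦ (‖(ξ : ℂ) - r * ζ‖ₑ ^ 2)⁻¹) (𝓝[<] 1)
      (𝓝 (‖(ξ : ℂ) - ζ‖ₑ ^ 2)⁻¹) := by
    have hcont : Continuous fun r : ℝ ↦ (‖(ξ : ℂ) - r * ζ‖ₑ ^ 2)⁻¹ :=
      ((ENNReal.continuous_pow 2).comp (by fun_prop)).inv
    simpa using (hcont.tendsto 1).mono_left nhdsWithin_le_nhds
  calc inverseSquarePotential μ ζ
      = ∫⁻ ξ : Circle, liminf (fun r : ℝ ↦ (‖(ξ : ℂ) - r * ζ‖ₑ ^ 2)⁻¹) (𝓝[<] 1) ∂μ :=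
        lintegral_congr fun ξ ↦ (hlim ξ).liminf_eq.symm
    _ ≤ liminf (fun r : ℝ ↦ inverseSquarePotential μ (r * ζ)) (𝓝[<] 1) :=
        lintegral_liminf_le fun r ↦ by fun_prop
    _ ≤ C := (liminf_le_liminf h).trans (liminf_const C).le

lemma le_two_mul_one_sub_exp_neg {u : ℝ} (hu : 0 ≤ u) (h : 1 / 2 ≤ Real.exp (-u)) :
    u ≤ 2 * (1 - Real.exp (-u)) := by
  have h_exp : Real.exp (-u) * Real.exp u = 1 := by
    rw [← Real.exp_add, neg_add_cancel, Real.exp_zero]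
  nlinarith [Real.add_one_le_exp u]

variable [IsFiniteMeasure μ]

lemma hasDerivAt_singularInner_radial {r : ℝ} (hr₀ : 0 ≤ r) (hr : r < 1) :
    HasDerivAt (fun t : ℝ ↦ singularInner μ (t * ζ)) (deriv (singularInner μ) (r * ζ) * ζ) r := by
  have hS := (hasDerivAt_singularInner μ
    (norm_ofReal_mul_circle_lt_one hr₀ hr ζ)).differentiableAt.hasDerivAt
  have hmul : HasDerivAt (fun t : ℂ ↦ t * (ζ : ℂ)) ζ (r : ℂ) := by
    simpa using (hasDerivAt_id (r : ℂ)).mul_const (ζ : ℂ)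
  exact (HasDerivAt.comp (r : ℂ) hS hmul).comp_ofReal

lemma one_sub_norm_singularInner_radial_le {M r : ℝ} (hr : r ∈ Ico (0 : ℝ) 1)
    (hM : ∀ t ∈ Ico r 1, ‖deriv (singularInner μ) (t * ζ)‖ ≤ M)
    (hS : Tendsto (fun r : ℝ ↦ ‖singularInner μ (r * ζ)‖) (𝓝[<] 1) (𝓝 1)) :
    1 - ‖singularInner μ (r * ζ)‖ ≤ M * (1 - r) := by
  have hM₀ : 0 ≤ M := (norm_nonneg _).trans (hM r ⟨le_rfl, hr.2⟩)
  refine le_of_tendsto (hS.sub_const _) ?_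
  filter_upwards [Ioo_mem_nhdsLT hr.2] with s hs
  calc ‖singularInner μ (s * ζ)‖ - ‖singularInner μ (r * ζ)‖
      ≤ ‖singularInner μ (s * ζ) - singularInner μ (r * ζ)‖ := norm_sub_norm_le _ _
    _ ≤ M * ‖s - r‖ := by
        refine (convex_Ico r 1).norm_image_sub_le_of_norm_hasDerivWithin_le
          (fun t ht ↦ (hasDerivAt_singularInner_radial
            (hr.1.trans ht.1) ht.2).hasDerivWithinAt) (fun t ht ↦ ?_)
          (left_mem_Ico.2 hr.2) ⟨hs.1.le, hs.2⟩
        rw [norm_mul, Circle.norm_coe, mul_one]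
        exact hM t ht
    _ ≤ M * (1 - r) := by
        rw [Real.norm_of_nonneg (by linarith [hs.1])]
        gcongr
        exact hs.2.le

lemma inverseSquarePotential_lt_top_of_eventually_norm_deriv_le {M : ℝ}
    (hM : ∀ᶠ r : ℝ in 𝓝[<] 1, ‖deriv (singularInner μ) (r * ζ)‖ ≤ M)
    (hS : Tendsto (fun r : ℝ ↦ ‖singularInner μ (r * ζ)‖) (𝓝[<] 1) (𝓝 1)) :
    inverseSquarePotential μ ζ < ∞ := by
  obtain ⟨r₀, hr₀, hM⟩ := (mem_nhdsLT_iff_exists_Ico_subset).1 hM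
  refine (inverseSquarePotential_le_of_eventually_radial_le (C := ENNReal.ofReal (2 * M))
    ?_).trans_lt ENNReal.ofReal_lt_top
  filter_upwards [eventually_mem_Ico_zero_one, Ico_mem_nhdsLT hr₀,
    hS.eventually_const_le one_half_lt_one] with r hr hr' hSr
  have hz := norm_ofReal_mul_circle_lt_one hr.1 hr.2 ζ
  refine (ENNReal.le_ofReal_iff_toReal_le (inverseSquarePotential_lt_top μ hz).ne ?_).2 ?_
  · linarith [(norm_nonneg _).trans (hM hr')]
  set V := (inverseSquarePotential μ (r * ζ)).toReal
  have hV : 0 ≤ V := ENNReal.toReal_nonneg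
  have hS_le := one_sub_norm_singularInner_radial_le hr
    (fun t ht ↦ hM ⟨hr'.1.trans ht.1, ht.2⟩) hS
  rw [norm_singularInner μ hz, norm_ofReal_mul_circle hr.1] at hSr hS_le
  refine le_of_mul_le_mul_left ?_ (sub_pos.2 hr.2)
  calc (1 - r) * V ≤ (1 - r ^ 2) * V := by
        gcongr
        nlinarith [hr.1, hr.2]
    _ ≤ 2 * (1 - Real.exp (-((1 - r ^ 2) * V))) :=
        le_two_mul_one_sub_exp_neg (mul_nonneg (by nlinarith [hr.1, hr.2]) hV) hSr
    _ ≤ (1 - r) * (2 * M) := by linarith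

lemma MemHardy.ae_exists_eventually_norm_radial_le {p : ℝ} (hp : 0 < p) {f : ℂ → ℂ}
    (hf : MemHardy p f) :
    ∀ᵐ ζ : Circle ∂circleArcLength, ∃ M, ∀ᶠ r : ℝ in 𝓝[<] 1, ‖f (r * ζ)‖ ≤ M := by
  obtain ⟨m, hm, h_le⟩ := hf.exists_measure_rpow_norm_le_poissonIntegral hp
  filter_upwards [ae_exists_eventually_poissonIntegral_radial_le m] with ζ ⟨B, hB, hζ⟩
  refine ⟨B.toReal ^ p⁻¹, ?_⟩
  filter_upwards [hζ, eventually_mem_Ico_zero_one] with r hr hr₀₁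
  rw [Real.le_rpow_inv_iff_of_pos (norm_nonneg _) ENNReal.toReal_nonneg hp,
    ← ENNReal.ofReal_le_iff_le_toReal hB.ne]
  exact (h_le _ (norm_ofReal_mul_circle_lt_one hr₀₁.1 hr₀₁.2 ζ)).trans hr

lemma MemHardy.ae_inverseSquarePotential_lt_top {p : ℝ} (hp : 0 < p)
    (hs : μ ⟂ₘ circleArcLength) (hμ : MemHardy p (deriv (singularInner μ))) :
    ∀ᵐ ζ : Circle ∂circleArcLength, inverseSquarePotential μ ζ < ∞ := by
  filter_upwards [hμ.ae_exists_eventually_norm_radial_le hp,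
    ae_tendsto_poissonIntegral_radial_zero hs] with ζ ⟨M, hM⟩ hζ
  exact inverseSquarePotential_lt_top_of_eventually_norm_deriv_le hM
    (tendsto_norm_singularInner_radial hζ)

end BoundedDerivative

lemma two_mul_div_circle_sub_sq (ξ ζ : Circle) :
    2 * (ξ : ℂ) / (ξ - ζ) ^ 2 = -(2 / (ζ : ℂ)) * (((‖(ξ : ℂ) - ζ‖ ^ 2)⁻¹ : ℝ) : ℂ) := by
  by_cases h : (ξ : ℂ) = ζ
  · simp [h]
  have hsub : (ξ : ℂ) - ζ ≠ 0 := sub_ne_zero.2 h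
  have hξ : (ξ : ℂ) ≠ 0 := ξ.coe_ne_zero
  have hζ : (ζ : ℂ) ≠ 0 := ζ.coe_ne_zero
  have hnorm : ((‖(ξ : ℂ) - ζ‖ ^ 2 : ℝ) : ℂ) = -((ξ : ℂ) - ζ) ^ 2 / (ξ * ζ) := by
    rw [← Complex.normSq_eq_norm_sq, Complex.normSq_eq_conj_mul_self, map_sub,
      ← Circle.coe_inv_eq_conj, ← Circle.coe_inv_eq_conj, Circle.coe_inv, Circle.coe_inv]
    field_simp
    ring
  rw [Complex.ofReal_inv, hnorm]
  field_simp

section RadialLimit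

variable {μ : Measure Circle} {ζ : Circle} (hV : inverseSquarePotential μ ζ < ∞)
include hV

lemma enorm_integral_two_mul_div_circle_sub_sq :
    ‖∫ ξ : Circle, 2 * (ξ : ℂ) / (ξ - ζ) ^ 2 ∂μ‖ₑ = 2 * inverseSquarePotential μ ζ := by
  simp_rw [two_mul_div_circle_sub_sq]
  rw [integral_const_mul, integral_complex_ofReal, inverseSquarePotential_eq_ofReal_integral hV,
    ← ofReal_norm, norm_mul, norm_neg, norm_div, Circle.norm_coe, Complex.norm_real,
    Real.norm_of_nonneg (integral_nonneg fun ξ ↦ by positivity), ENNReal.ofReal_mul (by positivity)]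
  simp

lemma tendsto_integral_two_mul_div_circle_sub_sq :
    Tendsto (fun r : ℝ ↦ ∫ ξ : Circle, 2 * (ξ : ℂ) / (ξ - r * ζ) ^ 2 ∂μ) (𝓝[<] 1)
      (𝓝 (∫ ξ : Circle, 2 * (ξ : ℂ) / (ξ - ζ) ^ 2 ∂μ)) := by
  have hne := ae_circle_ne_of_inverseSquarePotential_lt_top hV
  refine tendsto_integral_filter_of_dominated_convergence
    (fun ξ : Circle ↦ 8 * (‖(ξ : ℂ) - ζ‖ ^ 2)⁻¹) (Eventually.of_forall fun r ↦ ?_) ?_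
    ((integrable_inv_norm_circle_sub_sq hV).const_mul 8) ?_
  · exact Measurable.aestronglyMeasurable (by fun_prop)
  · filter_upwards [eventually_mem_Ico_zero_one] with r hr
    filter_upwards [hne] with ξ hξ
    have hpos : 0 < ‖(ξ : ℂ) - ζ‖ := norm_pos_iff.2 (sub_ne_zero.2 hξ)
    have hle := norm_circle_sub_le_two_mul ξ ζ hr.1 hr.2.le
    have hpos' : 0 < ‖(ξ : ℂ) - r * ζ‖ := by linarith
    simp only [norm_div, norm_mul, norm_pow, Circle.norm_coe, Complex.norm_ofNat, mul_one]
    rw [← div_eq_mul_inv, div_le_div_iff₀ (by positivity) (by positivity)]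
    nlinarith
  · filter_upwards [hne] with ξ hξ
    have hsub : Continuous fun r : ℝ ↦ (ξ : ℂ) - r * ζ := by fun_prop
    have hlim := (hsub.tendsto 1).mono_left (nhdsWithin_le_nhds (s := Iio 1))
    rw [Complex.ofReal_one, one_mul] at hlim
    exact tendsto_const_nhds.div (hlim.pow 2) (pow_ne_zero _ (sub_ne_zero.2 hξ))

lemma tendsto_enorm_deriv_singularInner_radial [IsFiniteMeasure μ] :
    Tendsto (fun r : ℝ ↦ ‖deriv (singularInner μ) (r * ζ)‖ₑ) (𝓝[<] 1)
      (𝓝 (2 * inverseSquarePotential μ ζ)) := by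
  have hS : Tendsto (fun r : ℝ ↦ ‖singularInner μ (r * ζ)‖ₑ) (𝓝[<] 1) (𝓝 1) := by
    simpa using ENNReal.tendsto_ofReal (tendsto_norm_singularInner_radial
      (tendsto_poissonIntegral_radial_of_potential_lt_top hV))
  have hprod := ENNReal.Tendsto.mul hS (Or.inl one_ne_zero)
    (tendsto_integral_two_mul_div_circle_sub_sq hV).enorm (Or.inr ENNReal.one_ne_top)
  rw [one_mul, enorm_integral_two_mul_div_circle_sub_sq hV] at hprod
  refine hprod.congr' ?_
  filter_upwards [eventually_mem_Ico_zero_one] with r hr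
  rw [(hasDerivAt_singularInner μ (norm_ofReal_mul_circle_lt_one hr.1 hr.2 ζ)).deriv, enorm_neg,
    enorm_mul]

end RadialLimit

lemma MemHardy.areaCondition {p : ℝ} (hp : 0 < p) {μ : Measure Circle} [IsFiniteMeasure μ]
    (hs : μ ⟂ₘ circleArcLength) (hμ : MemHardy p (deriv (singularInner μ))) :
    AreaCondition (1 + p) μ := by
  refine areaCondition_of_lintegral_potential_lt_top hp μ (lt_of_le_of_lt ?_ hμ.2)
  set g : ℝ → Circle → ℝ≥0∞ := fun r ζ ↦ ‖deriv (singularInner μ) (r * ζ)‖ₑ ^ p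
  have hg (r : ℝ) : Measurable (g r) :=
    ((measurable_deriv _).comp (by fun_prop)).enorm.pow_const p
  calc ∫⁻ ζ : Circle, inverseSquarePotential μ ζ ^ p ∂circleArcLength
      ≤ ∫⁻ ζ : Circle, liminf (fun r ↦ g r ζ) (𝓝[<] 1) ∂circleArcLength := by
        refine lintegral_mono_ae ?_
        filter_upwards [hμ.ae_inverseSquarePotential_lt_top hp hs] with ζ hζ
        rw [((tendsto_enorm_deriv_singularInner_radial hζ).ennrpow_const p).liminf_eq]
        gcongr
        exact le_mul_of_one_le_left zero_le one_le_two
    _ ≤ liminf (fun r ↦ ∫⁻ ζ : Circle, g r ζ ∂circleArcLength) (𝓝[<] 1) := lintegral_liminf_le hg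
    _ ≤ _ := by
        refine (liminf_le_liminf ?_).trans (liminf_const (f := 𝓝[<] (1 : ℝ)) _).le
        filter_upwards [eventually_mem_Ico_zero_one] with r hr
        exact le_iSup (fun r : Ico (0 : ℝ) 1 ↦ ∫⁻ ζ : Circle, g r ζ ∂circleArcLength) ⟨r, hr⟩

theorem mainTheorem8_general (p : ℝ) (hp0 : 0 < p) (hp : p < 1) :
    (∀ (μ : Measure Circle) [IsFiniteMeasure μ] (E : Set Circle),
      IsBeurlingCarleson (1 - p) E → μ Eᶜ = 0 →
      AreaCondition (1 + p) μ → MemHardy p (deriv (singularInner μ))) ∧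
    (∀ (μ : Measure Circle) [IsFiniteMeasure μ], μ ⟂ₘ circleArcLength →
      (UpToCountableSums (AreaCondition (1 + p)) μ ↔
        UpToCountableSums (fun ν ↦ MemHardy p (deriv (singularInner ν))) μ)) := by
  refine ⟨fun μ _ E hE hμ hA ↦ memHardy_deriv_of_lintegral_potential_lt_top hp0.le μ
    (lintegral_potential_lt_top_of_isBeurlingCarleson hp0 hp μ hE hμ hA), fun μ _ hs ↦ ?_⟩
  have hsingular {ν : ℕ → Measure Circle} (hsum : μ = Measure.sum ν) (k : ℕ) :
      ν k ⟂ₘ circleArcLength :=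
    hs.mono_ac (hsum ▸ (Measure.le_sum ν k).absolutelyContinuous) .rfl
  constructor
  · rintro ⟨ν, hν, hsum⟩
    rw [hsum]
    refine UpToCountableSums.bind fun k ↦ ?_
    have := (hν k).1
    exact (hν k).2.upToCountableSums_memHardy_deriv hp0 hp (hsingular hsum k)
  · rintro ⟨ν, hν, hsum⟩
    refine ⟨ν, fun k ↦ ⟨(hν k).1, ?_⟩, hsum⟩
    have := (hν k).1
    exact (hν k).2.areaCondition hp0 (hsingular hsum k)

theorem mainTheorem8 (p : ℝ) (hp0 : 0 < p) (hp : p < 1 / 2) :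
    (∀ (μ : Measure Circle) [IsFiniteMeasure μ] (E : Set Circle),
      IsBeurlingCarleson (1 - p) E → μ Eᶜ = 0 →
      AreaCondition (1 + p) μ → MemHardy p (deriv (singularInner μ))) ∧
    (∀ (μ : Measure Circle) [IsFiniteMeasure μ], μ ⟂ₘ circleArcLength →
      (UpToCountableSums (AreaCondition (1 + p)) μ ↔
        UpToCountableSums (fun ν => MemHardy p (deriv (singularInner ν))) μ)) :=
  mainTheorem8_general p hp0 (by linarith)
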